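/- Let $n$ be a non-negative integer, and let $\mathbb H^n=\mathbb R^n\times\mathbb R^n\times\mathbb R$ be the Heisenberg group with group law $(x,y,t)(x',y',t')=(x+x',\,y+y',\,t+t'+\tfrac12(x'\cdot y-y'\cdot x))$ and Haar measure $dx\,dy\,dt$. For $A\in\mathbb H^n$ let $L_A f(X)=f(A^{-1}X)$. For $\lambda\in\mathbb R^*=\mathbb R\setminus\{0\}$ let $\pi_\lambda$ be the representation of $\mathbb H^n$ on $L^2(\mathbb R^n)$ given by $\pi_\lambda(x,y,t)u(\xi)=e^{2\pi i\lambda t}e^{2\pi i\lambda(x\cdot\xi+\frac12 x\cdot y)}u(\xi+y)$. Let $\mathcal B_2$ be the space of Hilbert–Schmidt operators on $L^2(\mathbb R^n)$, with inner product $\langle S,T\rangle_{\mathcal B_2}=\operatorname{tr}(T^*S)$. The group Fourier transform $f\mapsto\widehat f$ is the unique continuous linear map $L^2(\mathbb H^n)\to L^2(\mathbb R^*,\mathcal B_2;|\lambda|^n d\lambda)$ such that $\widehat f(\lambda)=\int_{\mathbb H^n}f(x,y,t)\,\pi_\lambda(x,y,t)\,dx\,dy\,dt$ for a.e. $\lambda$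 whenever $f\in L^1\cap L^2(\mathbb H^n)$. For $\varphi\in L^2(\mathbb H^n)$ and $k,l\in\mathbb Z^n$ put $$G^\varphi_{k,l}(\lambda)=\sum_{r\in\mathbb Z}\big\langle\widehat\varphi(\lambda+r),\widehat{L_{(2k,l,0)}\varphi}(\lambda+r)\big\rangle_{\mathcal B_2}|\lambda+r|^n ,$$ a function that is defined for a.e. $\lambda\in\mathbb R$ and has period one. Let $V(\varphi)$ be the closed linear span in $L^2(\mathbb H^n)$ of $\{L_{(2k,l,m)}\varphi: k,l\in\mathbb Z^n,\ m\in\mathbb Z\}$. The function $\varphi$ satisfies condition C if $G^\varphi_{k,l}(\lambda)=0$ for a.e. $\lambda\in(0,1]$, for every $(k,l)\in\mathbb Z^{2n}\setminus\{(0,0)\}$. A canonical dual to $\varphi$ is a function $\tilde\varphi\in L^2(\mathbb H^n)$ such that $\langle L_{(2k,l,m)}\tilde\varphi,\varphi\rangle=\delta_{(k,l,m),(0,0,0)}$ for all $k,l\in\mathbb Z^n$, $m\in\mathbb Z$. **Theorem.** Let $\varphi\in L^2(\mathbb H^n)$ satisfy condition C. Then there exists a canonical dual $\tilde\varphi$ to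 $\varphi$ that belongs to $V(\varphi)$ if and only if $1/G^\varphi_{0,0}\in L^1(0,1]$ (with $1/0=\infty$, so that in particular $G^\varphi_{0,0}\neq0$ a.e. on $(0,1]$). Moreover, in this case every canonical dual $\tilde\varphi\in V(\varphi)$ to $\varphi$ satisfies $$\widehat{\tilde\varphi}(\lambda)=\frac{1}{G^\varphi_{0,0}(\lambda)}\,\widehat\varphi(\lambda)\qquad\text{for a.e. }\lambda\in\mathbb R^* .$$ -/

import Mathlib

open MeasureTheory Filter Topology
open scoped ENNReal ComplexConjugate

noncomputable section

namespace HeisenbergTranslates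

/-! ### The Heisenberg group -/

/-- `ℝⁿ` with its Euclidean structure and Lebesgue measure. -/
abbrev E (n : ℕ) : Type := EuclideanSpace ℝ (Fin n)

/-- The underlying manifold `ℝⁿ × ℝⁿ × ℝ` of the Heisenberg group `ℍⁿ`; its `volume` is Lebesgue
measure `dx dy dt`, which is the Haar measure of the group. -/
abbrev H (n : ℕ) : Type := E n × E n × ℝ

/-- The group law `(x,y,t)(x',y',t') = (x+x', y+y', t+t'+½(x'·y - y'·x))`. -/
def mulH {n : ℕ} (X Y : H n) : H n :=
  (X.1 + Y.1, X.2.1 + Y.2.1,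
    X.2.2 + Y.2.2 + (1 / 2 : ℝ) * (inner ℝ Y.1 X.2.1 - inner ℝ Y.2.1 X.1))

/-- The inverse `(x,y,t)⁻¹ = (-x,-y,-t)`. -/
def invH {n : ℕ} (X : H n) : H n := (-X.1, -X.2.1, -X.2.2)

theorem mulH_assoc {n : ℕ} (X Y Z : H n) : mulH (mulH X Y) Z = mulH X (mulH Y Z) := by
  simp only [mulH, inner_add_left, inner_add_right, Prod.mk.injEq, add_assoc, true_and]
  ring

theorem invH_mulH {n : ℕ} (X : H n) : mulH (invH X) X = 0 := by
  simp [mulH, invH, real_inner_comm, Prod.ext_iff]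

theorem zero_mulH {n : ℕ} (X : H n) : mulH 0 X = X := by
  simp [mulH]

/-- The lattice point `(2k, l, m)`. -/
def lat {n : ℕ} (k l : Fin n → ℤ) (m : ℤ) : H n :=
  (WithLp.toLp 2 fun i => 2 * (k i : ℝ), WithLp.toLp 2 fun i => (l i : ℝ), (m : ℝ))

theorem measurePreserving_mulH {n : ℕ} (X : H n) :
    MeasurePreserving (mulH X) (volume : Measure (H n)) volume := by
  have h2 : MeasurePreserving (fun p : H n => (X.1 + p.1, (X.2.1 + p.2.1,
      (X.2.2 + (1 / 2 : ℝ) * (inner ℝ p.1 X.2.1 - inner ℝ p.2.1 X.1)) + p.2.2)))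
      ((volume : Measure (E n)).prod ((volume : Measure (E n)).prod (volume : Measure ℝ)))
      ((volume : Measure (E n)).prod ((volume : Measure (E n)).prod (volume : Measure ℝ))) := by
    refine (measurePreserving_add_left (volume : Measure (E n)) X.1).skew_product
      (g := fun (x : E n) (q : E n × ℝ) => (X.2.1 + q.1,
        (X.2.2 + (1 / 2 : ℝ) * (inner ℝ x X.2.1 - inner ℝ q.1 X.1)) + q.2)) ?_ ?_
    · exact Continuous.measurable (by fun_prop)
    · refine ae_of_all _ fun x => MeasurePreserving.map_eq ?_
      refine (measurePreserving_add_left (volume : Measure (E n)) X.2.1).skew_product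
        (g := fun (y : E n) (t : ℝ) =>
          (X.2.2 + (1 / 2 : ℝ) * (inner ℝ x X.2.1 - inner ℝ y X.1)) + t) ?_ ?_
      · exact Continuous.measurable (by fun_prop)
      · exact ae_of_all _ fun y => (measurePreserving_add_left (volume : Measure ℝ) _).map_eq
  have h3 : mulH X = fun p : H n => (X.1 + p.1, (X.2.1 + p.2.1,
      (X.2.2 + (1 / 2 : ℝ) * (inner ℝ p.1 X.2.1 - inner ℝ p.2.1 X.1)) + p.2.2)) := by
    funext p
    simp only [mulH, Prod.mk.injEq, true_and]
    ring
  rw [h3]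
  exact h2

/-- `L²(ℝⁿ)`. -/
abbrev L2E (n : ℕ) : Type := Lp ℂ 2 (volume : Measure (E n))

/-- `L²(ℍⁿ)`. -/
abbrev L2H (n : ℕ) : Type := Lp ℂ 2 (volume : Measure (H n))

/-- Left translation `(L_A f)(X) = f(A⁻¹X)` on `L²(ℍⁿ)`. -/
def leftTranslate {n : ℕ} (A : H n) : L2H n →ₗᵢ[ℂ] L2H n :=
  Lp.compMeasurePreservingₗᵢ ℂ (mulH (invH A)) (measurePreserving_mulH (invH A))

/-- The principal shift-invariant space `V(φ)`: the closed linear span of all `L_(2k,l,m) φ`. -/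
def V {n : ℕ} (φ : L2H n) : Submodule ℂ (L2H n) :=
  (Submodule.span ℂ (Set.range fun p : (Fin n → ℤ) × (Fin n → ℤ) × ℤ =>
    leftTranslate (lat p.1 p.2.1 p.2.2) φ)).topologicalClosure

/-! ### The representations `π_lam` -/

/-- The unimodular number `e^{2πis}`. -/
def e (s : ℝ) : ℂ := Complex.exp (2 * Real.pi * Complex.I * s)

theorem norm_e (s : ℝ) : ‖e s‖ = 1 := by
  have h : (2 * Real.pi * Complex.I * s : ℂ) = ((2 * Real.pi * s : ℝ) : ℂ) * Complex.I := by
    push_cast; ring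
  rw [e, h, Complex.norm_exp_ofReal_mul_I]

theorem continuous_e : Continuous e := by
  unfold e; fun_prop

theorem memLp_phase {n : ℕ} (θ : C(E n, ℝ)) (u : L2E n) :
    MemLp (fun ξ => e (θ ξ) * u ξ) 2 (volume : Measure (E n)) := by
  refine (Lp.memLp u).of_le (((continuous_e.comp θ.continuous).aestronglyMeasurable).mul
    (Lp.aestronglyMeasurable u)) (ae_of_all _ fun ξ => ?_)
  simp [norm_e]

/-- Multiplication by the unimodular function `ξ ↦ e^{2πiθ(ξ)}` on `L²(ℝⁿ)`. -/
def phase {n : ℕ} (θ : C(E n, ℝ)) : L2E n →ₗᵢ[ℂ] L2E n where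
  toFun u := (memLp_phase θ u).toLp _
  map_add' u v := by
    refine Lp.ext ?_
    filter_upwards [(memLp_phase θ (u + v)).coeFn_toLp, (memLp_phase θ u).coeFn_toLp,
      (memLp_phase θ v).coeFn_toLp, Lp.coeFn_add u v,
      Lp.coeFn_add ((memLp_phase θ u).toLp _) ((memLp_phase θ v).toLp _)] with ξ h1 h2 h3 h4 h5
    rw [h1, h5, Pi.add_apply, h2, h3, h4, Pi.add_apply, mul_add]
  map_smul' c u := by
    refine Lp.ext ?_
    filter_upwards [(memLp_phase θ (c • u)).coeFn_toLp, (memLp_phase θ u).coeFn_toLp,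
      Lp.coeFn_smul c u, Lp.coeFn_smul c ((memLp_phase θ u).toLp _)] with ξ h1 h2 h3 h4
    simp only [RingHom.id_apply]
    rw [h1, h4, Pi.smul_apply, h2, h3, Pi.smul_apply, smul_eq_mul, smul_eq_mul]
    ring
  norm_map' u := by
    refine le_antisymm (Lp.norm_le_norm_of_ae_le ?_) (Lp.norm_le_norm_of_ae_le ?_)
    · filter_upwards [(memLp_phase θ u).coeFn_toLp] with ξ h
      simp only [LinearMap.coe_mk, AddHom.coe_mk]
      rw [h, norm_mul, norm_e, one_mul]
    · filter_upwards [(memLp_phase θ u).coeFn_toLp] with ξ h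
      simp only [LinearMap.coe_mk, AddHom.coe_mk]
      rw [h, norm_mul, norm_e, one_mul]

theorem phase_ae {n : ℕ} (θ : C(E n, ℝ)) (u : L2E n) :
    phase θ u =ᵐ[volume] fun ξ => e (θ ξ) * u ξ :=
  (memLp_phase θ u).coeFn_toLp

/-- The representation
`(π_lam(x,y,t) u)(ξ) = e^{2πi lam t} e^{2πi lam (x·ξ + ½ x·y)} u(ξ + y)` on `L²(ℝⁿ)`. -/
def rep {n : ℕ} (lam : ℝ) (X : H n) : L2E n →ₗᵢ[ℂ] L2E n :=
  (phase ⟨fun ξ => lam * (X.2.2 + inner ℝ X.1 ξ + (1 / 2 : ℝ) * inner ℝ X.1 X.2.1),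
      by fun_prop⟩).comp
    (Lp.compMeasurePreservingₗᵢ ℂ (fun ξ : E n => ξ + X.2.1)
      (measurePreserving_add_right volume X.2.1))

theorem rep_ae {n : ℕ} (lam : ℝ) (X : H n) (u : L2E n) :
    rep lam X u =ᵐ[volume] fun ξ =>
      e (lam * X.2.2) * e (lam * (inner ℝ X.1 ξ + (1 / 2 : ℝ) * inner ℝ X.1 X.2.1)) *
        u (ξ + X.2.1) := by
  have h := Lp.coeFn_compMeasurePreserving u (measurePreserving_add_right volume X.2.1)
  refine (phase_ae _ _).trans ?_
  filter_upwards [h] with ξ hξ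
  simp only [Lp.compMeasurePreservingₗᵢ, ContinuousMap.coe_mk] at hξ ⊢
  erw [hξ]
  simp only [Function.comp, e, ← Complex.exp_add]
  congr 2
  push_cast
  ring

theorem continuous_phase {n : ℕ} {Z : Type*} [TopologicalSpace Z] [FirstCountableTopology Z]
    (θ : Z → C(E n, ℝ)) (hθ : ∀ ξ, Continuous fun z => θ z ξ) (u : L2E n) :
    Continuous fun z => phase (θ z) u := by
  have hweak : ∀ w : L2E n, Continuous fun z => inner ℂ w (phase (θ z) u) := by
    intro w
    have h1 : (fun z => inner ℂ w (phase (θ z) u)) =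
        fun z => ∫ ξ, inner ℂ (w ξ) (e (θ z ξ) * u ξ) := by
      funext z
      rw [L2.inner_def]
      refine integral_congr_ae ?_
      filter_upwards [phase_ae (θ z) u] with ξ h
      rw [h]
    rw [h1]
    refine continuous_of_dominated (bound := fun ξ => ‖w ξ‖ * ‖u ξ‖) (fun z => ?_)
      (fun z => ae_of_all _ fun ξ => ?_) ?_ (ae_of_all _ fun ξ => ?_)
    · exact (Lp.aestronglyMeasurable w).inner (memLp_phase (θ z) u).1
    · refine (norm_inner_le_norm _ _).trans_eq ?_
      rw [norm_mul, norm_e, one_mul]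
    · exact (Lp.memLp w).norm.integrable_mul (Lp.memLp u).norm
    · exact continuous_const.inner ((continuous_e.comp (hθ ξ)).mul continuous_const)
  rw [continuous_iff_continuousAt]
  intro z₀
  rw [ContinuousAt, tendsto_iff_norm_sub_tendsto_zero]
  have h2 : ∀ z, ‖phase (θ z) u - phase (θ z₀) u‖ =
      Real.sqrt (2 * ‖u‖ ^ 2 - 2 * (inner ℂ (phase (θ z₀) u) (phase (θ z) u)).re) := by
    intro z
    rw [← Real.sqrt_sq (norm_nonneg (phase (θ z) u - phase (θ z₀) u)), norm_sub_rev,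
      @norm_sub_sq ℂ, LinearIsometry.norm_map, LinearIsometry.norm_map]
    congr 1
    simp only [RCLike.re_to_complex]
    ring
  have h3 : Continuous fun z =>
      Real.sqrt (2 * ‖u‖ ^ 2 - 2 * (inner ℂ (phase (θ z₀) u) (phase (θ z) u)).re) :=
    Real.continuous_sqrt.comp (continuous_const.sub
      (continuous_const.mul (Complex.continuous_re.comp (hweak _))))
  simp only [h2]
  have h4 := h3.tendsto z₀
  simp only [← h2, sub_self, norm_zero] at h4
  simpa only [h2] using h4

/-- `π_lam` is strongly continuous. -/
theorem continuous_rep {n : ℕ} (lam : ℝ) (u : L2E n) :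
    Continuous fun X : H n => rep lam X u := by
  have htr : Continuous fun X : H n => Lp.compMeasurePreservingₗᵢ ℂ (fun ξ : E n => ξ + X.2.1)
      (measurePreserving_add_right volume X.2.1) u := by
    refine Continuous.compMeasurePreservingLp
      (g := fun X : H n => (⟨fun ξ : E n => ξ + X.2.1, by fun_prop⟩ : C(E n, E n)))
      continuous_const ?_ (fun X => measurePreserving_add_right volume X.2.1) (by simp)
    exact ContinuousMap.continuous_of_continuous_uncurry _ (by
      simp only [Function.uncurry_def, ContinuousMap.coe_mk]; fun_prop)
  rw [continuous_iff_continuousAt]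
  intro X₀
  set θ : H n → C(E n, ℝ) := fun X =>
    ⟨fun ξ => lam * (X.2.2 + inner ℝ X.1 ξ + (1 / 2 : ℝ) * inner ℝ X.1 X.2.1), by fun_prop⟩
    with hθ
  set τ : H n → L2E n := fun X => Lp.compMeasurePreservingₗᵢ ℂ (fun ξ : E n => ξ + X.2.1)
      (measurePreserving_add_right volume X.2.1) u with hτ
  have hrep : ∀ X, rep lam X u = phase (θ X) (τ X) := fun X => rfl
  have hph : Continuous fun X => phase (θ X) (τ X₀) :=
    continuous_phase θ (fun ξ => by simp only [hθ, ContinuousMap.coe_mk]; fun_prop) _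
  have h1 : Tendsto (fun X => phase (θ X) (τ X - τ X₀)) (𝓝 X₀) (𝓝 0) := by
    rw [tendsto_zero_iff_norm_tendsto_zero]
    simp only [LinearIsometry.norm_map]
    exact tendsto_iff_norm_sub_tendsto_zero.1 (htr.tendsto X₀)
  have h2 := h1.add (hph.tendsto X₀)
  simp only [← map_add, sub_add_cancel, zero_add] at h2
  exact h2

/-! ### The group Fourier transform -/

theorem integrable_smul_rep {n : ℕ} {f : H n → ℂ} (hf : Integrable f) (lam : ℝ) (u : L2E n) :
    Integrable fun X => f X • rep lam X u := by
  refine (hf.norm.mul_const ‖u‖).mono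
    (hf.1.smul (continuous_rep lam u).aestronglyMeasurable) (ae_of_all _ fun X => ?_)
  simp [norm_smul]

/-- The group Fourier transform of `f ∈ L¹(ℍⁿ)`: the bounded operator
`u ↦ ∫ f(x,y,t) π_lam(x,y,t) u dx dy dt` (a Bochner integral in `L²(ℝⁿ)`). -/
def fourierL1 {n : ℕ} (f : H n → ℂ) (hf : Integrable f) (lam : ℝ) : L2E n →L[ℂ] L2E n :=
  LinearMap.mkContinuous
    { toFun := fun u => ∫ X, f X • rep lam X u
      map_add' := fun u v => by
        simp only [map_add, smul_add]
        exact integral_add (integrable_smul_rep hf lam u) (integrable_smul_rep hf lam v)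
      map_smul' := fun c u => by
        simp only [map_smul, RingHom.id_apply]
        rw [← integral_smul]
        simp only [smul_comm c] }
    (∫ X, ‖f X‖)
    (fun u => by
      refine (norm_integral_le_integral_norm _).trans_eq ?_
      simp only [norm_smul, LinearIsometry.norm_map]
      exact integral_mul_const _ _)

/-- A fixed orthonormal basis of `L²(ℝⁿ)`, used to compute Hilbert-Schmidt norms and inner
products (which do not depend on the choice of the basis). -/
def onb (n : ℕ) : HilbertBasis (exists_hilbertBasis ℂ (L2E n)).choose ℂ (L2E n) :=
  (exists_hilbertBasis ℂ (L2E n)).choose_spec.choose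

/-- The squared Hilbert-Schmidt norm `∑ ‖S eᵢ‖²`, with value `∞` if `S` is not Hilbert-Schmidt. -/
def hsSq {n : ℕ} (S : L2E n →L[ℂ] L2E n) : ℝ≥0∞ := ∑' i, ‖S (onb n i)‖ₑ ^ 2

/-- The inner product `⟨S, T⟩ = tr(T* S) = ∑ ⟨S eᵢ, T eᵢ⟩` of Hilbert-Schmidt operators, linear in
`S` (the inner product of Mathlib is linear in its second argument). -/
def hsInner {n : ℕ} (S T : L2E n →L[ℂ] L2E n) : ℂ := ∑' i, inner ℂ (T (onb n i)) (S (onb n i))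

/-- `T` represents the group Fourier transform of `f ∈ L²(ℍⁿ)`: it is an element of
`L²(ℝ*, B₂; |lam|ⁿ dlam)`, and the limit in this space of the transforms of a sequence in
`L¹(ℍⁿ) ∩ L²(ℍⁿ)` that converges to `f` in `L²(ℍⁿ)`.  By the Plancherel theorem such a `T` exists
and is unique up to equality almost everywhere. -/
structure IsFourier {n : ℕ} (f : L2H n) (T : ℝ → (L2E n →L[ℂ] L2E n)) : Prop where
  measurable : ∀ u v : L2E n, AEStronglyMeasurable (fun lam => inner ℂ u (T lam v)) volume
  finite : ∫⁻ lam : ℝ, hsSq (T lam) * ENNReal.ofReal (|lam| ^ n) < ∞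
  limit : ∃ (F : ℕ → L2H n) (hF : ∀ j, Integrable (F j : H n → ℂ)),
    Tendsto F atTop (𝓝 f) ∧
    Tendsto (fun j => ∫⁻ lam : ℝ, hsSq (fourierL1 (F j) (hF j) lam - T lam) *
      ENNReal.ofReal (|lam| ^ n)) atTop (𝓝 0)

open Classical in
/-- The group Fourier transform `f̂` of `f ∈ L²(ℍⁿ)` (a representative of its class). -/
def fourier {n : ℕ} (f : L2H n) : ℝ → (L2E n →L[ℂ] L2E n) :=
  if h : ∃ T, IsFourier f T then h.choose else 0

/-! ### The functions `G_{k,l}`, condition C and canonical duals -/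

/-- `G_{k,l}(lam) = ∑_{r ∈ ℤ} ⟨φ̂(lam+r), (L_(2k,l,0)φ)^(lam+r)⟩_{B₂} |lam+r|ⁿ`.  The formula is
used for all real `lam`, so that `G` is extended from `(0,1]` with period one. -/
def G {n : ℕ} (φ : L2H n) (k l : Fin n → ℤ) (lam : ℝ) : ℂ :=
  ∑' r : ℤ, hsInner (fourier φ (lam + r)) (fourier (leftTranslate (lat k l 0) φ) (lam + r)) *
    ((|lam + r| ^ n : ℝ) : ℂ)

/-- Condition C: `G_{k,l} = 0` almost everywhere on `(0,1]` for all `(k,l) ≠ (0,0)`. -/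
def ConditionC {n : ℕ} (φ : L2H n) : Prop :=
  ∀ k l : Fin n → ℤ, (k, l) ≠ (0, 0) →
    ∀ᵐ lam ∂(volume.restrict (Set.Ioc (0 : ℝ) 1)), G φ k l lam = 0

/-- `ψ` is a canonical dual to `φ`: `⟨L_(2k,l,m) ψ, φ⟩ = δ_{(k,l,m),(0,0,0)}` for all `k, l, m`. -/
def IsCanonicalDual {n : ℕ} (ψ φ : L2H n) : Prop :=
  ∀ (k l : Fin n → ℤ) (m : ℤ),
    inner ℂ φ (leftTranslate (lat k l m) ψ) = if (k, l, m) = (0, 0, 0) then 1 else 0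

/-- `1/g ∈ L¹(0,1]`, where `1/0 = ∞`: `g` vanishes almost nowhere on `(0,1]`, and `1/g` is
integrable there. -/
def InvIntegrable (g : ℝ → ℂ) : Prop :=
  (∀ᵐ lam ∂(volume.restrict (Set.Ioc (0 : ℝ) 1)), g lam ≠ 0) ∧
    IntegrableOn (fun lam => (g lam)⁻¹) (Set.Ioc 0 1) volume

end HeisenbergTranslates

end

/-!
# Canonical duals in spaces generated by lattice translates on the Heisenberg group

Taking the Fourier transform in the centre turns translation by `(0, 0, m)` into multiplication of
`f̂(lam)` by `e^{2πim lam}` (`fourier_leftTranslate_central_ae`), a function of period one.  By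
Plancherel's theorem the inner products `⟨L_(0,0,m) f, g⟩` are therefore the Fourier coefficients of
the periodic function `bracket f g = ∑_r ⟨f̂(· + r), ĝ(· + r)⟩ |· + r|ⁿ` (`integral_e_mul_bracket`),
and `G φ k l` is the bracket of `φ` with `L_(2k,l,0) φ`.

* If `ψ` is a canonical dual, then `bracket ψ φ` has the Fourier coefficients of the constant `1`,
  so it equals `1` almost everywhere, and the Cauchy-Schwarz inequality
  `1 ≤ bracket ψ ψ * bracket φ φ`, where `bracket φ φ = G φ 0 0`, shows
  that `1 / G φ 0 0` is integrable (`IsCanonicalDual.invIntegrable`).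
* If `1 / G φ 0 0` is integrable, then `p = 1 / G φ 0 0` is square integrable for the weight
  `G φ 0 0`.  Trigonometric polynomials are dense in this weighted space, so `p φ̂` is a limit of
  transforms of combinations of the `L_(0,0,m) φ`, hence the transform of some `ψ` in `V φ`
  (`exists_fourier_eq_smul`).  The bracket of `ψ` with `φ` is `1`, and condition C makes `ψ`
  orthogonal to the translates with `(k, l) ≠ (0, 0)`: `ψ` is a canonical dual
  (`exists_isCanonicalDual`).
* Two canonical duals in `V φ` differ by a vector of `V φ` orthogonal to all generators of `V φ`
  (`eq_of_isCanonicalDual`), so every dual in `V φ` is the one just constructed.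

The analytic input is the Plancherel theorem of the group.  For `F` in `L¹ ∩ L²` the operator
`π_lam(F)` has an explicit integral kernel (`fourierL1_ae_kernel`) whose `L²` norm is computed by
the Euclidean Plancherel theorem, in the variable `x` for fixed `lam` and then in the central
variable (`lintegral_hsSq_fourierL1`).  The transform of a general `f` in `L²` is obtained as a limit
(`exists_isFourier`); its norm (`IsFourier.fieldNorm_eq`) and uniqueness (`IsFourier.ae_unique`)
follow by continuity.
-/

noncomputable section

namespace HeisenbergTranslates

theorem lintegral_enorm_sq_eq_eLpNorm {α : Type*} [MeasurableSpace α] (μ : Measure α)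
    (g : α → ℂ) : ∫⁻ x, ‖g x‖ₑ ^ 2 ∂μ = eLpNorm g 2 μ ^ 2 := by
  have h := eLpNorm_nnreal_pow_eq_lintegral (f := g) (μ := μ) (p := 2) two_ne_zero
  simpa using h.symm

/-! ### Plancherel's theorem in Euclidean space -/

section Plancherel

open FourierTransform SchwartzMap

variable {W : Type*} [NormedAddCommGroup W] [InnerProductSpace ℝ W] [FiniteDimensional ℝ W]
  [MeasurableSpace W] [BorelSpace W]

/-- On `L¹ ∩ L²` the `L²` Fourier transform agrees with the Fourier integral: both have the same
pairings with test functions. -/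
theorem fourier_toLp_ae_eq {f : W → ℂ} (h1 : Integrable f) (h2 : MemLp f 2) :
    (𝓕 (h2.toLp f) : Lp ℂ 2 (volume : Measure W)) =ᵐ[volume] 𝓕 f := by
  have hcont : Continuous (𝓕 f) :=
    VectorFourier.fourierIntegral_continuous Real.continuous_fourierChar
      (by exact continuous_inner) h1
  refine ae_eq_of_integral_contDiff_smul_eq
    ((Lp.memLp (𝓕 (h2.toLp f) : Lp ℂ 2 (volume : Measure W))).locallyIntegrable (by norm_num))
    hcont.locallyIntegrable ?_
  intro g g_smooth g_cpt
  have hg₁ : HasCompactSupport (Complex.ofRealCLM ∘ g) := g_cpt.comp_left rfl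
  have hg₂ : ContDiff ℝ ((⊤ : ℕ∞) : WithTop ℕ∞) (Complex.ofRealCLM ∘ g) := by fun_prop
  set S : 𝓢(W, ℂ) := hg₁.toSchwartzMap hg₂ with hS
  have hSapp : ∀ x, S x = (g x : ℂ) := fun x => rfl
  have key := congrArg (fun T => T S) (Lp.fourier_toTemperedDistribution_eq (h2.toLp f))
  simp only [TemperedDistribution.fourier_apply, Lp.toTemperedDistribution_apply] at key
  have hflip := VectorFourier.integral_fourierIntegral_smul_eq_flip (L := innerₗ W)
    (μ := volume) (ν := volume) Real.continuous_fourierChar (by exact continuous_inner)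
    (S.integrable) h1
  have e1 : ∫ x, g x • (𝓕 (h2.toLp f) : Lp ℂ 2 (volume : Measure W)) x =
      ∫ x, (𝓕 S) x • (h2.toLp f) x := by
    rw [key]
    refine integral_congr_ae (ae_of_all _ fun x => ?_)
    simp [hSapp]
  rw [e1]
  have e2 : ∫ x, (𝓕 S) x • (h2.toLp f) x = ∫ x, (𝓕 S) x • f x := by
    refine integral_congr_ae ?_
    filter_upwards [h2.coeFn_toLp] with x hx
    rw [hx]
  rw [e2]
  rw [flip_innerₗ] at hflip
  refine hflip.trans ?_
  refine integral_congr_ae (ae_of_all _ fun x => ?_)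
  simp only [hSapp, Complex.real_smul, smul_eq_mul]
  rfl

/-- **Plancherel's theorem** for functions in `L¹ ∩ L²`, with the Fourier transform given by its
integral. -/
theorem lintegral_enorm_sq_fourier {f : W → ℂ} (h1 : Integrable f) (h2 : MemLp f 2) :
    ∫⁻ w, ‖𝓕 f w‖ₑ ^ 2 = ∫⁻ w, ‖f w‖ₑ ^ 2 := by
  rw [lintegral_enorm_sq_eq_eLpNorm, lintegral_enorm_sq_eq_eLpNorm,
    ← eLpNorm_congr_ae (fourier_toLp_ae_eq h1 h2)]
  have h := Lp.norm_fourier_eq (h2.toLp f)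
  rw [Lp.norm_def, Lp.norm_def, ENNReal.toReal_eq_toReal_iff' (Lp.eLpNorm_ne_top _)
    (Lp.eLpNorm_ne_top _)] at h
  rw [h, eLpNorm_congr_ae h2.coeFn_toLp]

/-- Plancherel's theorem with the character `e^{2πi⟨w, ξ⟩}`. -/
theorem lintegral_enorm_sq_integral_e {f : W → ℂ} (h1 : Integrable f) (h2 : MemLp f 2) :
    ∫⁻ w, ‖∫ x, f x * e (inner ℝ x w)‖ₑ ^ 2 = ∫⁻ w, ‖f w‖ₑ ^ 2 := by
  rw [← lintegral_enorm_sq_fourier h1 h2,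
    ← (Measure.measurePreserving_neg (volume : Measure W)).lintegral_comp_emb
      (MeasurableEquiv.neg W).measurableEmbedding]
  refine lintegral_congr fun w => ?_
  rw [Real.fourier_eq]
  congr 3
  funext x
  rw [Circle.smul_def, smul_eq_mul, mul_comm, Real.fourierChar_apply, e]
  congr 2
  simp
  ring

end Plancherel

/-! ### Periodization -/

section Periodization

theorem e_add (s t : ℝ) : e (s + t) = e s * e t := by
  rw [e, e, e, ← Complex.exp_add]; congr 1; push_cast; ring

theorem e_intCast (m : ℤ) : e m = 1 := by
  rw [e, Complex.exp_eq_one_iff]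
  exact ⟨m, by push_cast; ring⟩

theorem e_zero : e 0 = 1 := by simpa using e_intCast 0

theorem conj_e (s : ℝ) : conj (e s) = e (-s) := by
  rw [e, e, ← Complex.exp_conj]; congr 1
  simp [Complex.conj_ofNat]

theorem e_intCast_mul_add (m r : ℤ) (s : ℝ) : e (m * (s + r)) = e (m * s) := by
  rw [mul_add, e_add]
  have h := e_intCast (m * r)
  push_cast at h
  rw [h, mul_one]

/-- Unfolding over the fundamental domain `(0,1]` of `ℝ/ℤ`. -/
theorem lintegral_eq_lintegral_Ioc_tsum {F : ℝ → ℝ≥0∞} (hF : AEMeasurable F) :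
    ∫⁻ s, F s = ∫⁻ s in Set.Ioc (0 : ℝ) 1, ∑' r : ℤ, F (s + r) := by
  have hmp : ∀ r : ℤ, MeasurePreserving (fun s : ℝ => s + r) := fun r =>
    measurePreserving_add_right volume (r : ℝ)
  have hF' : ∀ r : ℤ, AEMeasurable (fun s => F (s + r)) (volume.restrict (Set.Ioc (0 : ℝ) 1)) :=
    fun r => (hF.comp_quasiMeasurePreserving (hmp r).quasiMeasurePreserving).restrict
  rw [lintegral_tsum hF', ← setLIntegral_univ,
    ← iUnion_Ioc_intCast ℝ, lintegral_iUnion (fun _ => measurableSet_Ioc)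
      (Set.pairwise_disjoint_Ioc_intCast ℝ)]
  refine tsum_congr fun r => ?_
  rw [← (hmp r).setLIntegral_comp_preimage_emb
    (MeasurableEquiv.addRight (r : ℝ)).measurableEmbedding F]
  congr 2
  ext s
  simp

theorem ae_tsum_ne_top {F : ℝ → ℝ≥0∞} (hF : AEMeasurable F) (hfin : ∫⁻ s, F s ≠ ∞) :
    ∀ᵐ s ∂(volume.restrict (Set.Ioc (0 : ℝ) 1)), ∑' r : ℤ, F (s + r) ≠ ∞ := by
  rw [lintegral_eq_lintegral_Ioc_tsum hF] at hfin
  filter_upwards [ae_lt_top' (AEMeasurable.tsum fun r : ℤ =>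
    (hF.comp_quasiMeasurePreserving
      (measurePreserving_add_right volume (r : ℝ)).quasiMeasurePreserving).restrict) hfin]
    with s hs using hs.ne

/-- A property that holds almost everywhere on the line holds at all integer translates of almost
every point. -/
theorem ae_forall_add_intCast {p : ℝ → Prop} (h : ∀ᵐ s, p s) : ∀ᵐ s : ℝ, ∀ r : ℤ, p (s + r) :=
  ae_all_iff.2 fun r =>
    (measurePreserving_add_right volume (r : ℝ)).quasiMeasurePreserving.ae h

/-- A translation invariant property that holds almost everywhere on `(0,1]` holds almost everywhere
on the line. -/
theorem ae_of_ae_Ioc {p : ℝ → Prop} (hp : ∀ (s : ℝ) (r : ℤ), p (s + r) → p s)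
    (h : ∀ᵐ s ∂(volume.restrict (Set.Ioc (0 : ℝ) 1)), p s) : ∀ᵐ s : ℝ, p s := by
  rw [ae_restrict_iff' measurableSet_Ioc] at h
  filter_upwards [ae_forall_add_intCast h] with s hs
  refine hp s (-(⌈s⌉ - 1)) (hs _ ⟨?_, ?_⟩)
  · push_cast; linarith [Int.ceil_lt_add_one s]
  · push_cast; linarith [Int.le_ceil s]

/-- Unfolding for integrable complex functions. -/
theorem integrable_tsum_add_intCast {b : ℝ → ℂ} (hb : Integrable b) :
    IntegrableOn (fun s => ∑' r : ℤ, b (s + r)) (Set.Ioc 0 1) ∧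
      ∫ s in Set.Ioc (0 : ℝ) 1, ∑' r : ℤ, b (s + r) = ∫ s, b s := by
  have hmp : ∀ r : ℤ, MeasurePreserving (fun s : ℝ => s + r) := fun r =>
    measurePreserving_add_right volume (r : ℝ)
  have hi : ∀ r : ℤ, Integrable (fun s => b (s + r)) (volume.restrict (Set.Ioc (0 : ℝ) 1)) :=
    fun r => (hb.comp_add_right (r : ℝ)).restrict
  have hset : ∀ (g : ℝ → ℂ) (r : ℤ),
      ∫ s in Set.Ioc (0 : ℝ) 1, g (s + r) = ∫ s in Set.Ioc (r : ℝ) (r + 1), g s := by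
    intro g r
    rw [← (hmp r).setIntegral_preimage_emb
      (MeasurableEquiv.addRight (r : ℝ)).measurableEmbedding g]
    congr 2
    ext s
    simp
  have hsum : ∀ g : ℝ → ℂ, Integrable g →
      HasSum (fun r : ℤ => ∫ s in Set.Ioc (0 : ℝ) 1, g (s + r)) (∫ s, g s) := by
    intro g hg
    simp only [hset]
    have h := hasSum_integral_iUnion (f := g) (μ := volume)
      (fun i : ℤ => measurableSet_Ioc (a := (i : ℝ)) (b := i + 1))
      (Set.pairwise_disjoint_Ioc_intCast ℝ) hg.integrableOn
    rwa [iUnion_Ioc_intCast, setIntegral_univ] at h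
  have hfin : ∑' r : ℤ, ∫⁻ s in Set.Ioc (0 : ℝ) 1, ‖b (s + r)‖ₑ ≠ ∞ := by
    rw [← lintegral_tsum fun r => (hi r).1.enorm, ← lintegral_eq_lintegral_Ioc_tsum hb.1.enorm]
    exact hb.2.ne
  refine ⟨?_, ?_⟩
  · refine ⟨?_, ?_⟩
    · refine ⟨fun s => ∑' r : ℤ, (hi r).1.mk _ s, ?_, ?_⟩
      · refine Measurable.stronglyMeasurable ?_
        exact Measurable.tsum fun r => (hi r).1.measurable_mk
      · filter_upwards [ae_all_iff.2 fun r => (hi r).1.ae_eq_mk] with s hs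
        exact tsum_congr hs
    · refine lt_of_le_of_lt (lintegral_mono fun s => enorm_tsum_le_tsum_enorm) ?_
      rw [lintegral_tsum fun r => (hi r).1.enorm]
      exact hfin.lt_top
  · rw [integral_tsum (fun r => (hi r).1) hfin]
    exact (hsum b hb).tsum_eq

/-- The Fourier coefficients of a periodization are values of the Fourier transform. -/
theorem integral_e_mul_tsum {b : ℝ → ℂ} (hb : Integrable b) (m : ℤ) :
    ∫ s in Set.Ioc (0 : ℝ) 1, e (m * s) * ∑' r : ℤ, b (s + r) = ∫ s, e (m * s) * b s := by
  have h : Integrable fun s => e (m * s) * b s :=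
    hb.bdd_mul (c := 1)
      (continuous_e.comp (continuous_const.mul continuous_id)).aestronglyMeasurable
      (ae_of_all _ fun s => (norm_e _).le)
  rw [← (integrable_tsum_add_intCast h).2]
  simp only [e_intCast_mul_add, tsum_mul_left]

end Periodization

/-! ### The trigonometric system on the unit interval -/

section TrigonometricSystem

theorem fourier_coe_eq_e (m : ℤ) (s : ℝ) :
    _root_.fourier m ((s : ℝ) : AddCircle (1 : ℝ)) = e (m * s) := by
  rw [fourier_coe_apply, e]
  congr 1
  push_cast
  ring

/-- If all Fourier coefficients of an integrable function on `(0,1]` vanish, so does its integral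
against every continuous function on the circle. -/
theorem integral_continuous_mul_eq_zero {h : ℝ → ℂ} (hh : IntegrableOn h (Set.Ioc 0 1))
    (h0 : ∀ m : ℤ, ∫ s in Set.Ioc (0 : ℝ) 1, e (m * s) * h s = 0) (c : C(AddCircle (1 : ℝ), ℂ)) :
    ∫ s in Set.Ioc (0 : ℝ) 1, c ((s : ℝ) : AddCircle (1 : ℝ)) * h s = 0 := by
  have hmeas : ∀ c : C(AddCircle (1 : ℝ), ℂ), AEStronglyMeasurable
      (fun s : ℝ => c (s : AddCircle (1 : ℝ))) (volume.restrict (Set.Ioc (0 : ℝ) 1)) := fun c =>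
    (c.continuous.comp (AddCircle.continuous_mk' 1)).aestronglyMeasurable
  have hint : ∀ c : C(AddCircle (1 : ℝ), ℂ), Integrable
      (fun s : ℝ => c (s : AddCircle (1 : ℝ)) * h s) (volume.restrict (Set.Ioc (0 : ℝ) 1)) :=
    fun c => hh.bdd_mul (c := ‖c‖) (hmeas c) (ae_of_all _ fun s => c.norm_coe_le_norm _)
  let Λ : C(AddCircle (1 : ℝ), ℂ) →L[ℂ] ℂ := LinearMap.mkContinuous
    { toFun := fun c => ∫ s in Set.Ioc (0 : ℝ) 1, c ((s : ℝ) : AddCircle (1 : ℝ)) * h s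
      map_add' := fun c d => by
        simp only [ContinuousMap.add_apply, add_mul]
        exact integral_add (hint c) (hint d)
      map_smul' := fun a c => by
        simp only [ContinuousMap.smul_apply, smul_eq_mul, mul_assoc, RingHom.id_apply]
        exact integral_const_mul _ _ }
    (∫ s in Set.Ioc (0 : ℝ) 1, ‖h s‖)
    (fun c => by
      rw [mul_comm, ← integral_const_mul]
      refine norm_integral_le_of_norm_le (hh.norm.const_mul _) (ae_of_all _ fun s => ?_)
      rw [norm_mul]
      gcongr
      exact c.norm_coe_le_norm _)
  have hle : Submodule.span ℂ (Set.range (@_root_.fourier (1 : ℝ))) ≤ Λ.ker := by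
    rw [Submodule.span_le]
    rintro _ ⟨m, rfl⟩
    change ∫ s in Set.Ioc (0 : ℝ) 1, _root_.fourier m ((s : ℝ) : AddCircle (1 : ℝ)) * h s = 0
    simp only [fourier_coe_eq_e, h0]
  have htop := Submodule.topologicalClosure_minimal _ hle Λ.isClosed_ker
  rw [span_fourier_closure_eq_top] at htop
  exact htop (Submodule.mem_top (x := c))

/-- An integrable function on `(0,1]` whose Fourier coefficients all vanish is zero almost
everywhere. -/
theorem ae_eq_zero_of_integral_e_mul {h : ℝ → ℂ} (hh : IntegrableOn h (Set.Ioc 0 1))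
    (h0 : ∀ m : ℤ, ∫ s in Set.Ioc (0 : ℝ) 1, e (m * s) * h s = 0) :
    ∀ᵐ s ∂(volume.restrict (Set.Ioc (0 : ℝ) 1)), h s = 0 := by
  have key := isOpen_Ioo.ae_eq_zero_of_integral_contDiff_smul_eq_zero (U := Set.Ioo (0 : ℝ) 1)
    (f := h) (μ := volume) ((hh.mono_set Set.Ioo_subset_Ioc_self).locallyIntegrableOn) ?_
  · rw [← Measure.restrict_congr_set (Ioo_ae_eq_Ioc (a := (0 : ℝ)) (b := 1)),
      ae_restrict_iff' measurableSet_Ioo]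
    exact key
  intro g g_smooth _ g_supp
  have hz : ∀ s, s ∉ Set.Ioo (0 : ℝ) 1 → g s = 0 := fun s hs =>
    image_eq_zero_of_notMem_tsupport fun hs' => hs (g_supp hs')
  -- A test function supported in `(0,1)` extends to a continuous function on the circle.
  let c : C(AddCircle (1 : ℝ), ℂ) :=
    ⟨AddCircle.liftIoc 1 0 fun s => (g s : ℂ), AddCircle.liftIoc_zero_continuous
      (by rw [hz 0 (by simp), hz 1 (by simp)])
      (Complex.continuous_ofReal.comp g_smooth.continuous).continuousOn⟩
  have hc := integral_continuous_mul_eq_zero hh h0 c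
  rw [← hc, ← integral_indicator measurableSet_Ioc]
  refine integral_congr_ae (ae_of_all _ fun s => ?_)
  by_cases hs : s ∈ Set.Ioc (0 : ℝ) 1
  · simp only [Set.indicator_of_mem hs]
    change _ = AddCircle.liftIoc 1 0 (fun s => (g s : ℂ)) s * h s
    rw [AddCircle.liftIoc_zero_coe_apply hs, Complex.real_smul]
  · simp only [Set.indicator_of_notMem hs]
    rw [hz s fun hs' => hs (Set.Ioo_subset_Ioc_self hs'), zero_smul]

theorem integral_e_intCast_mul (m : ℤ) :
    ∫ s in Set.Ioc (0 : ℝ) 1, e (m * s) = if m = 0 then 1 else 0 := by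
  split_ifs with hm
  · simp [hm, e_zero]
  · rw [← intervalIntegral.integral_of_le zero_le_one]
    have hc : (2 * Real.pi * Complex.I * m : ℂ) ≠ 0 := by
      simp [Real.pi_ne_zero, hm]
    have h := integral_exp_mul_complex (a := 0) (b := 1) hc
    have h1 : Complex.exp (2 * Real.pi * Complex.I * m * (1 : ℝ)) = 1 := by
      rw [Complex.exp_eq_one_iff]
      exact ⟨m, by push_cast; ring⟩
    rw [h1] at h
    simp only [Complex.ofReal_zero, mul_zero, Complex.exp_zero, sub_self, zero_div] at h
    rw [← h]
    refine intervalIntegral.integral_congr fun s _ => ?_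
    simp only [e]
    congr 1
    push_cast
    ring

/-- Trigonometric polynomials `∑ cₘ e^{2πims}`, indexed by their coefficients. -/
def trigPoly : (ℤ →₀ ℂ) →ₗ[ℂ] (ℝ → ℂ) :=
  Finsupp.linearCombination ℂ fun (m : ℤ) (s : ℝ) => e (m * s)

theorem trigPoly_apply (c : ℤ →₀ ℂ) (s : ℝ) :
    trigPoly c s = c.sum fun m a => a * e (m * s) := by
  simp [trigPoly, Finsupp.linearCombination_apply, Finsupp.sum]

theorem continuous_trigPoly (c : ℤ →₀ ℂ) : Continuous (trigPoly c) := by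
  have : trigPoly c = fun s => c.sum fun m a => a * e (m * s) := funext (trigPoly_apply c)
  rw [this]
  exact continuous_finsetSum _ fun m _ =>
    continuous_const.mul (continuous_e.comp (continuous_const.mul continuous_id))

theorem trigPoly_add_intCast (c : ℤ →₀ ℂ) (s : ℝ) (r : ℤ) :
    trigPoly c (s + r) = trigPoly c s := by
  simp only [trigPoly_apply, e_intCast_mul_add]

theorem exists_norm_trigPoly_le (c : ℤ →₀ ℂ) : ∃ C : ℝ, ∀ s, ‖trigPoly c s‖ ≤ C := by
  refine ⟨∑ m ∈ c.support, ‖c m‖, fun s => ?_⟩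
  rw [trigPoly_apply]
  refine (norm_sum_le _ _).trans (Finset.sum_le_sum fun m _ => ?_)
  rw [norm_mul, norm_e, mul_one]

/-- Trigonometric polynomials are dense in `L²((0,1], w ds)` for every integrable weight `w`. -/
theorem exists_trigPoly_tendsto_of_measurable {w : ℝ → ℝ≥0∞} (hw : Measurable w)
    (hfin : ∫⁻ s in Set.Ioc (0 : ℝ) 1, w s ≠ ∞) {p : ℝ → ℂ} (hp : Measurable p)
    (hp2 : ∫⁻ s in Set.Ioc (0 : ℝ) 1, ‖p s‖ₑ ^ 2 * w s ≠ ∞) :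
    ∃ c : ℕ → ℤ →₀ ℂ, Tendsto
      (fun j => ∫⁻ s in Set.Ioc (0 : ℝ) 1, ‖trigPoly (c j) s - p s‖ₑ ^ 2 * w s) atTop (𝓝 0) := by
  set μ : Measure ℝ := (volume.restrict (Set.Ioc (0 : ℝ) 1)).withDensity w with hμ
  have : IsFiniteMeasure μ := isFiniteMeasure_withDensity hfin
  have hsq : ∀ g : ℝ → ℂ, Measurable g →
      eLpNorm g 2 μ ^ 2 = ∫⁻ s in Set.Ioc (0 : ℝ) 1, ‖g s‖ₑ ^ 2 * w s := by
    intro g hg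
    rw [← lintegral_enorm_sq_eq_eLpNorm, hμ,
      lintegral_withDensity_eq_lintegral_mul _ hw (hg.enorm.pow_const 2)]
    simp only [Pi.mul_apply, mul_comm]
  have hpL : MemLp p 2 μ := by
    refine ⟨hp.aestronglyMeasurable, ?_⟩
    by_contra hcon
    rw [not_lt, top_le_iff] at hcon
    have := hsq p hp
    rw [hcon, ENNReal.top_pow two_ne_zero] at this
    exact hp2 this.symm
  have hqL : ∀ c, MemLp (trigPoly c) 2 μ := fun c => by
    obtain ⟨C, hC⟩ := exists_norm_trigPoly_le c
    exact MemLp.of_bound (continuous_trigPoly c).aestronglyMeasurable C (ae_of_all _ hC)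
  let Q : (ℤ →₀ ℂ) →ₗ[ℂ] Lp ℂ 2 μ :=
    { toFun := fun c => (hqL c).toLp _
      map_add' := fun c d => by
        rw [← MemLp.toLp_add]
        exact MemLp.toLp_congr _ _ (by rw [map_add])
      map_smul' := fun a c => by
        rw [RingHom.id_apply, ← MemLp.toLp_const_smul]
        exact MemLp.toLp_congr _ _ (by rw [map_smul]) }
  have hdense : (LinearMap.range Q).topologicalClosure = ⊤ := by
    rw [Submodule.topologicalClosure_eq_top_iff, Submodule.eq_bot_iff]
    intro h hh
    -- If `h` is orthogonal to all characters in `L²(w ds)`, all Fourier coefficients of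
    -- `w h` vanish.
    rw [Submodule.mem_orthogonal] at hh
    have hwt : ∀ᵐ s ∂(volume.restrict (Set.Ioc (0 : ℝ) 1)), w s < ∞ := ae_lt_top hw hfin
    have h1 : Integrable h μ := (Lp.memLp h).integrable one_le_two
    have h2 : IntegrableOn (fun s => (w s).toReal • h s) (Set.Ioc 0 1) :=
      (integrable_withDensity_iff_integrable_smul' hw hwt).1 h1
    have h3 : ∀ m : ℤ, ∫ s in Set.Ioc (0 : ℝ) 1, e (m * s) * ((w s).toReal • h s) = 0 := by
      intro m
      have h4 := hh (Q (Finsupp.single (-m) 1)) ⟨_, rfl⟩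
      rw [L2.inner_def] at h4
      have h5 : ∫ s, e (m * s) * h s ∂μ = 0 := by
        rw [← h4]
        refine integral_congr_ae ?_
        filter_upwards [(hqL (Finsupp.single (-m) 1)).coeFn_toLp] with s hs
        change _ = inner ℂ ((hqL (Finsupp.single (-m) 1)).toLp _ s) (h s)
        rw [hs, RCLike.inner_apply', trigPoly_apply, Finsupp.sum_single_index (by simp),
          one_mul, conj_e]
        congr 2
        push_cast
        ring
      have h6 : ∫ s in Set.Ioc (0 : ℝ) 1, (w s).toReal • (e (m * s) * h s) = 0 :=
        (integral_withDensity_eq_integral_toReal_smul hw hwt _).symm.trans h5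
      refine Eq.trans ?_ h6
      refine integral_congr_ae (ae_of_all _ fun s => ?_)
      simp only [Complex.real_smul]
      ring
    have h6 := ae_eq_zero_of_integral_e_mul h2 h3
    rw [Lp.eq_zero_iff_ae_eq_zero]
    refine (ae_withDensity_iff hw).2 ?_
    filter_upwards [h6, hwt] with s hs hs' hs''
    exact (smul_eq_zero.1 hs).resolve_left (ENNReal.toReal_ne_zero.2 ⟨hs'', hs'.ne⟩)
  have hmem : hpL.toLp p ∈ closure (LinearMap.range Q : Set (Lp ℂ 2 μ)) := by
    rw [← Submodule.topologicalClosure_coe, hdense]; trivial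
  obtain ⟨u, hu, hlim⟩ := mem_closure_iff_seq_limit.1 hmem
  choose c hc using hu
  refine ⟨c, ?_⟩
  have h1 : ∀ j, ∫⁻ s in Set.Ioc (0 : ℝ) 1, ‖trigPoly (c j) s - p s‖ₑ ^ 2 * w s =
      (edist (u j) (hpL.toLp p)) ^ 2 := by
    intro j
    rw [← hc j]
    change _ = edist ((hqL (c j)).toLp _) _ ^ 2
    rw [Lp.edist_toLp_toLp, hsq _ ((continuous_trigPoly _).measurable.sub hp)]
    rfl
  simp only [h1]
  have h2 := ENNReal.Tendsto.pow (n := 2) (tendsto_iff_edist_tendsto_0.1 hlim)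
  simpa using h2

theorem exists_trigPoly_tendsto {w : ℝ → ℝ≥0∞}
    (hw : AEMeasurable w (volume.restrict (Set.Ioc (0 : ℝ) 1)))
    (hfin : ∫⁻ s in Set.Ioc (0 : ℝ) 1, w s ≠ ∞) {p : ℝ → ℂ}
    (hp : AEMeasurable p (volume.restrict (Set.Ioc (0 : ℝ) 1)))
    (hp2 : ∫⁻ s in Set.Ioc (0 : ℝ) 1, ‖p s‖ₑ ^ 2 * w s ≠ ∞) :
    ∃ c : ℕ → ℤ →₀ ℂ, Tendsto
      (fun j => ∫⁻ s in Set.Ioc (0 : ℝ) 1, ‖trigPoly (c j) s - p s‖ₑ ^ 2 * w s) atTop (𝓝 0) := by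
  have h2 : ∫⁻ s in Set.Ioc (0 : ℝ) 1, ‖hp.mk p s‖ₑ ^ 2 * hw.mk w s =
      ∫⁻ s in Set.Ioc (0 : ℝ) 1, ‖p s‖ₑ ^ 2 * w s := by
    refine lintegral_congr_ae ?_
    filter_upwards [hw.ae_eq_mk, hp.ae_eq_mk] with s h3 h4
    rw [h3, h4]
  obtain ⟨c, hc⟩ := exists_trigPoly_tendsto_of_measurable hw.measurable_mk
    (by rwa [← lintegral_congr_ae hw.ae_eq_mk]) hp.measurable_mk (h2 ▸ hp2)
  refine ⟨c, hc.congr fun j => lintegral_congr_ae ?_⟩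
  filter_upwards [hw.ae_eq_mk, hp.ae_eq_mk] with s h3 h4
  rw [h3, h4]

end TrigonometricSystem

/-! ### Parseval's identity in the Hilbert-Schmidt setting -/

section HilbertSchmidt

/-- An orthonormal basis of a separable Hilbert space is countable, since its members are at
mutual distance at least one. -/
theorem countable_of_hilbertBasis {𝓗 ι : Type*} [NormedAddCommGroup 𝓗] [InnerProductSpace ℂ 𝓗]
    [SecondCountableTopology 𝓗] (b : HilbertBasis ι ℂ 𝓗) : Countable ι := by
  have hinj : Function.Injective b := b.orthonormal.linearIndependent.injective
  have hdist : ∀ i j : ι, i ≠ j → (1 : ℝ) ≤ dist (b i) (b j) := by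
    intro i j hij
    have h1 : ‖b i - b j‖ ^ 2 = 2 := by
      rw [@norm_sub_sq ℂ, b.orthonormal.2 hij, b.orthonormal.1, b.orthonormal.1]
      norm_num
    rw [dist_eq_norm]
    nlinarith [norm_nonneg (b i - b j)]
  have hd : DiscreteTopology (Set.range b) := by
    refine DiscreteTopology.of_forall_le_dist one_pos ?_
    rintro ⟨_, i, rfl⟩ ⟨_, j, rfl⟩ hij
    exact hdist i j fun h => hij (by rw [h])
  have hc : Countable (Set.range b) :=
    TopologicalSpace.separableSpace_iff_countable.1 inferInstance
  exact (Equiv.ofInjective b hinj).countable_iff.2 hc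

/-- Countability of the index set of `onb n` lets sums over it be interchanged with integrals. -/
instance countable_onb (n : ℕ) : Countable (exists_hilbertBasis ℂ (L2E n)).choose :=
  have : Fact ((2 : ℝ≥0∞) ≠ ∞) := ⟨ENNReal.ofNat_ne_top⟩
  countable_of_hilbertBasis (onb n)

/-- Parseval's identity in `ℝ≥0∞`. -/
theorem tsum_enorm_sq_inner {𝓗 ι : Type*} [NormedAddCommGroup 𝓗] [InnerProductSpace ℂ 𝓗]
    (b : HilbertBasis ι ℂ 𝓗) (x : 𝓗) : ∑' i, ‖inner ℂ (b i) x‖ₑ ^ 2 = ‖x‖ₑ ^ 2 := by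
  have h := b.hasSum_inner_mul_inner x x
  have h1 : ∀ i, inner ℂ x (b i) * inner ℂ (b i) x = ((‖inner ℂ (b i) x‖ ^ 2 : ℝ) : ℂ) := by
    intro i
    rw [← inner_conj_symm, RCLike.conj_mul]
    norm_cast
  simp only [h1, inner_self_eq_norm_sq_to_K] at h
  have h2 : HasSum (fun i => ‖inner ℂ (b i) x‖ ^ 2) (‖x‖ ^ 2) := by
    have : HasSum (fun i => ((‖inner ℂ (b i) x‖ ^ 2 : ℝ) : ℂ)) ((‖x‖ ^ 2 : ℝ) : ℂ) := by
      convert! h using 1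
      push_cast; rfl
    exact_mod_cast this
  have h3 : ∀ z : ℝ, 0 ≤ z → ENNReal.ofReal (z ^ 2) = ENNReal.ofReal z ^ 2 := fun z hz =>
    ENNReal.ofReal_pow hz 2
  have h4 := ENNReal.ofReal_tsum_of_nonneg (fun i => sq_nonneg ‖inner ℂ (b i) x‖) h2.summable
  rw [h2.tsum_eq, h3 _ (norm_nonneg _), ofReal_norm] at h4
  rw [h4]
  refine tsum_congr fun i => ?_
  rw [h3 _ (norm_nonneg _), ofReal_norm]

theorem lintegral_enorm_sq_coeFn {α : Type*} [MeasurableSpace α] {μ : Measure α}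
    (u : Lp ℂ 2 μ) : ∫⁻ x, ‖u x‖ₑ ^ 2 ∂μ = ‖u‖ₑ ^ 2 := by
  rw [lintegral_enorm_sq_eq_eLpNorm, Lp.enorm_def]

theorem memLp_two_iff_lintegral {α : Type*} [MeasurableSpace α] {μ : Measure α}
    {g : α → ℂ} (hg : AEStronglyMeasurable g μ) : MemLp g 2 μ ↔ ∫⁻ x, ‖g x‖ₑ ^ 2 ∂μ ≠ ∞ := by
  rw [lintegral_enorm_sq_eq_eLpNorm, MemLp]
  simp [hg, lt_top_iff_ne_top]

/-- Parseval's identity in `L²`, for the bilinear pairing with a square integrable function. -/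
theorem tsum_enorm_sq_integral_mul {n : ℕ} {g : E n → ℂ} (hg : MemLp g 2) :
    ∑' i, ‖∫ η, g η * onb n i η‖ₑ ^ 2 = ∫⁻ η, ‖g η‖ₑ ^ 2 := by
  have hg' : MemLp (fun η => conj (g η)) 2 (volume : Measure (E n)) :=
    hg.of_le (Complex.continuous_conj.comp_aestronglyMeasurable hg.1)
      (ae_of_all _ fun η => by simp)
  have h := tsum_enorm_sq_inner (onb n) (hg'.toLp _)
  have h1 : ‖hg'.toLp _‖ₑ ^ 2 = ∫⁻ η, ‖g η‖ₑ ^ 2 := by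
    rw [Lp.enorm_toLp, ← lintegral_enorm_sq_eq_eLpNorm]
    simp
  rw [← h1, ← h]
  refine tsum_congr fun i => ?_
  have h2 : ∫ η, g η * onb n i η = inner ℂ (hg'.toLp _) (onb n i) := by
    rw [L2.inner_def]
    refine integral_congr_ae ?_
    filter_upwards [hg'.coeFn_toLp] with η hη
    rw [hη, RCLike.inner_apply', RCLike.conj_conj]
  rw [h2, ← inner_conj_symm, RCLike.enorm_conj]

end HilbertSchmidt

/-! ### The pointwise formula for the integrated representation -/

section IntegralKernel

/-- The integrand of `(π_lam(F) u)(ξ)`. -/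
def repIntegrand {n : ℕ} (F : H n → ℂ) (lam : ℝ) (u : L2E n) (X : H n) (ξ : E n) : ℂ :=
  F X * (e (lam * X.2.2) * e (lam * (inner ℝ X.1 ξ + (1 / 2 : ℝ) * inner ℝ X.1 X.2.1)) *
    u (ξ + X.2.1))

theorem stronglyMeasurable_repIntegrand {n : ℕ} {F : H n → ℂ} (hF : StronglyMeasurable F)
    (lam : ℝ) (u : L2E n) :
    StronglyMeasurable (fun p : H n × E n => repIntegrand F lam u p.1 p.2) := by
  refine (hF.comp_measurable measurable_fst).mul ?_
  refine StronglyMeasurable.mul ?_ ((Lp.stronglyMeasurable u).comp_measurable ?_)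
  · refine Continuous.stronglyMeasurable ?_
    exact (continuous_e.comp (by fun_prop)).mul (continuous_e.comp (by fun_prop))
  · exact Continuous.measurable (by fun_prop)

/-- Joint integrability over `ℍⁿ × s` for a set `s` of finite measure, on which `L²` functions are
integrable. -/
theorem integrable_repIntegrand {n : ℕ} {F : H n → ℂ} (hF : StronglyMeasurable F)
    (hFi : Integrable F) (lam : ℝ) (u : L2E n) {s : Set (E n)} (hs : volume s < ∞) :
    Integrable (fun p : H n × E n => repIntegrand F lam u p.1 p.2)
      ((volume : Measure (H n)).prod (volume.restrict s)) := by
  refine ⟨(stronglyMeasurable_repIntegrand hF lam u).aestronglyMeasurable, ?_⟩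
  have hfin : IsFiniteMeasure ((volume : Measure (E n)).restrict s) := ⟨by simpa using hs⟩
  rw [HasFiniteIntegral, lintegral_prod _
    (stronglyMeasurable_repIntegrand hF lam u).measurable.enorm.aemeasurable]
  set C : ℝ≥0∞ := ‖u‖ₑ * ((volume : Measure (E n)).restrict s) Set.univ ^ (1 / 2 : ℝ) with hC
  have hCfin : C ≠ ∞ := ENNReal.mul_ne_top enorm_ne_top
    (ENNReal.rpow_ne_top_of_nonneg (by norm_num) (measure_ne_top _ _))
  have hb : ∀ X : H n, ∫⁻ ξ in s, ‖repIntegrand F lam u X ξ‖ₑ ≤ ‖F X‖ₑ * C := by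
    intro X
    have h1 : ∀ ξ, ‖repIntegrand F lam u X ξ‖ₑ = ‖F X‖ₑ * ‖u (ξ + X.2.1)‖ₑ := by
      intro ξ
      simp only [repIntegrand, enorm_mul]
      simp [← ofReal_norm, norm_e]
    simp only [h1]
    have hmp := measurePreserving_add_right (volume : Measure (E n)) X.2.1
    have hm : AEStronglyMeasurable (fun ξ => u (ξ + X.2.1)) (volume : Measure (E n)) :=
      (Lp.aestronglyMeasurable u).comp_measurePreserving hmp
    rw [lintegral_const_mul'' _ hm.restrict.enorm]
    gcongr
    have h2 := eLpNorm_le_eLpNorm_mul_rpow_measure_univ (p := 1) (q := 2) one_le_two hm.restrict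
      (μ := (volume : Measure (E n)).restrict s)
    rw [eLpNorm_one_eq_lintegral_enorm] at h2
    refine h2.trans ?_
    rw [hC]
    have h3 : (1 / (1 : ℝ≥0∞).toReal - 1 / (2 : ℝ≥0∞).toReal : ℝ) = 1 / 2 := by norm_num
    rw [h3]
    gcongr
    refine (eLpNorm_mono_measure _ Measure.restrict_le_self).trans ?_
    rw [Lp.enorm_def]
    exact (eLpNorm_comp_measurePreserving (Lp.aestronglyMeasurable u) hmp).le
  refine lt_of_le_of_lt (lintegral_mono hb) ?_
  rw [lintegral_mul_const _ hF.measurable.enorm]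
  exact ENNReal.mul_lt_top hFi.2 hCfin.lt_top

theorem ae_integrable_repIntegrand {n : ℕ} {F : H n → ℂ} (hF : StronglyMeasurable F)
    (hFi : Integrable F) (lam : ℝ) (u : L2E n) :
    ∀ᵐ ξ : E n, Integrable fun X => repIntegrand F lam u X ξ := by
  refine ae_of_forall_measure_lt_top_ae_restrict _ fun s _ hs => ?_
  exact (integrable_repIntegrand hF hFi lam u hs).prod_left_ae

/-- The operator `π_lam(F)`, defined by a Bochner integral in `L²(ℝⁿ)`, is computed by the
pointwise integral. -/
theorem fourierL1_ae {n : ℕ} {F : H n → ℂ} (hF : StronglyMeasurable F) (hFi : Integrable F)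
    (lam : ℝ) (u : L2E n) :
    fourierL1 F hFi lam u =ᵐ[volume] fun ξ => ∫ X, repIntegrand F lam u X ξ := by
  -- Both sides have the same integral over every set of finite measure, by Fubini's theorem.
  refine ae_eq_of_forall_setIntegral_eq_of_sigmaFinite
    (fun s _ hs => integrableOn_Lp_of_measure_ne_top _ one_le_two hs.ne)
    (fun s _ hs => (integrable_repIntegrand hF hFi lam u hs).integral_prod_right)
    fun s hsm hs => ?_
  have h1 : fourierL1 F hFi lam u = ∫ X, F X • rep lam X u := rfl
  rw [← L2.inner_indicatorConstLp_one (𝕜 := ℂ) hsm hs.ne, h1,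
    ← integral_inner (integrable_smul_rep hFi lam u),
    ← integral_integral_swap (integrable_repIntegrand hF hFi lam u hs)]
  refine integral_congr_ae (ae_of_all _ fun X => ?_)
  simp only
  rw [inner_smul_right, L2.inner_indicatorConstLp_one, ← integral_const_mul]
  refine integral_congr_ae ?_
  filter_upwards [ae_restrict_of_ae (rep_ae lam X u)] with ξ hξ
  rw [hξ, repIntegrand]

end IntegralKernel

/-! ### Integral kernels and the Plancherel formula on `L¹ ∩ L²` -/

section KernelFormula

/-- The coordinates of `ℍⁿ` in the order `((y, x), t)`. -/
def rearrange (n : ℕ) : (E n × E n) × ℝ ≃ᵐ H n :=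
  ((MeasurableEquiv.prodComm (α := E n) (β := E n)).prodCongr (MeasurableEquiv.refl ℝ)).trans
    MeasurableEquiv.prodAssoc

theorem rearrange_apply {n : ℕ} (q : (E n × E n) × ℝ) :
    rearrange n q = (q.1.2, q.1.1, q.2) := rfl

theorem measurePreserving_rearrange (n : ℕ) :
    MeasurePreserving (rearrange n)
      (((volume : Measure (E n)).prod (volume : Measure (E n))).prod (volume : Measure ℝ))
      (volume : Measure (H n)) :=
  (measurePreserving_prodAssoc (volume : Measure (E n)) (volume : Measure (E n))
    (volume : Measure ℝ)).comp
    (Measure.measurePreserving_swap.prod (MeasurePreserving.id (volume : Measure ℝ)))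

/-- The Fourier transform of `F` in the central variable, as a function of `(y, x)`. -/
def centralFourier {n : ℕ} (F : H n → ℂ) (lam : ℝ) (p : E n × E n) : ℂ :=
  ∫ t : ℝ, F (p.2, p.1, t) * e (lam * t)

/-- The integral kernel `k(ξ, η - ξ)` of `π_lam(F)`, as a function of `ξ` and `y = η - ξ`. -/
def repKernel {n : ℕ} (F : H n → ℂ) (lam : ℝ) (ξ y : E n) : ℂ :=
  ∫ x : E n, centralFourier F lam (y, x) * e (lam * (inner ℝ x ξ + (1 / 2 : ℝ) * inner ℝ x y))

theorem stronglyMeasurable_centralFourier_uncurry {n : ℕ} {F : H n → ℂ}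
    (hF : StronglyMeasurable F) :
    StronglyMeasurable fun q : ℝ × (E n × E n) => centralFourier F q.1 q.2 := by
  refine StronglyMeasurable.integral_prod_right'
    (f := fun r : (ℝ × (E n × E n)) × ℝ => F (r.1.2.2, r.1.2.1, r.2) * e (r.1.1 * r.2)) ?_
  refine (hF.comp_measurable ?_).mul (continuous_e.comp ?_).stronglyMeasurable
  · exact Continuous.measurable (by fun_prop)
  · fun_prop

theorem stronglyMeasurable_centralFourier {n : ℕ} {F : H n → ℂ} (hF : StronglyMeasurable F)
    (lam : ℝ) : StronglyMeasurable (centralFourier F lam) :=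
  (stronglyMeasurable_centralFourier_uncurry hF).comp_measurable measurable_prodMk_left

theorem integrable_rearrange {n : ℕ} {F : H n → ℂ} (hFi : Integrable F) :
    Integrable (fun q : (E n × E n) × ℝ => F (q.1.2, q.1.1, q.2))
      (((volume : Measure (E n)).prod (volume : Measure (E n))).prod (volume : Measure ℝ)) :=
  (measurePreserving_rearrange n).integrable_comp_of_integrable hFi

theorem integrable_centralFourier {n : ℕ} {F : H n → ℂ} (hFi : Integrable F) (lam : ℝ) :
    Integrable (centralFourier F lam) ((volume : Measure (E n)).prod (volume : Measure (E n))) := by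
  have h : Integrable (fun q : (E n × E n) × ℝ => F (q.1.2, q.1.1, q.2) * e (lam * q.2))
      (((volume : Measure (E n)).prod (volume : Measure (E n))).prod (volume : Measure ℝ)) :=
    (integrable_rearrange hFi).mul_bdd (c := 1)
      (continuous_e.comp (by fun_prop)).aestronglyMeasurable
      (ae_of_all _ fun q => (norm_e _).le)
  exact h.integral_prod_left

theorem stronglyMeasurable_repKernel {n : ℕ} {F : H n → ℂ} (hF : StronglyMeasurable F)
    (lam : ℝ) : StronglyMeasurable fun q : E n × E n => repKernel F lam q.1 q.2 := by
  refine StronglyMeasurable.integral_prod_right'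
    (f := fun r : (E n × E n) × E n => centralFourier F lam (r.1.2, r.2) *
      e (lam * (inner ℝ r.2 r.1.1 + (1 / 2 : ℝ) * inner ℝ r.2 r.1.2))) ?_
  refine ((stronglyMeasurable_centralFourier hF lam).comp_measurable ?_).mul
    (continuous_e.comp ?_).stronglyMeasurable
  · exact Continuous.measurable (by fun_prop)
  · fun_prop

/-- `π_lam(F)` is the integral operator with kernel `repKernel F lam ξ (η - ξ)`. -/
theorem fourierL1_ae_kernel {n : ℕ} {F : H n → ℂ} (hF : StronglyMeasurable F)
    (hFi : Integrable F) (lam : ℝ) (u : L2E n) :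
    fourierL1 F hFi lam u =ᵐ[volume] fun ξ => ∫ η, repKernel F lam ξ (η - ξ) * u η := by
  filter_upwards [fourierL1_ae hF hFi lam u, ae_integrable_repIntegrand hF hFi lam u] with ξ h1 h2
  have hsub : ∫ η, repKernel F lam ξ (η - ξ) * u η = ∫ y, repKernel F lam ξ y * u (ξ + y) := by
    rw [← integral_add_left_eq_self _ ξ]
    simp
  rw [h1, hsub, ← (measurePreserving_rearrange n).integral_comp (rearrange n).measurableEmbedding]
  have h3 : Integrable (fun q => repIntegrand F lam u (rearrange n q) ξ)
      (((volume : Measure (E n)).prod (volume : Measure (E n))).prod (volume : Measure ℝ)) :=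
    (measurePreserving_rearrange n).integrable_comp_of_integrable h2
  rw [integral_prod _ h3]
  have h4 : ∀ p : E n × E n, ∫ t, repIntegrand F lam u (rearrange n (p, t)) ξ =
      centralFourier F lam p * e (lam * (inner ℝ p.2 ξ + (1 / 2 : ℝ) * inner ℝ p.2 p.1)) *
        u (ξ + p.1) := by
    intro p
    rw [centralFourier, ← integral_mul_const, ← integral_mul_const]
    refine integral_congr_ae (ae_of_all _ fun t => ?_)
    simp only [rearrange_apply, repIntegrand]
    ring
  have h5 := h3.integral_prod_left
  simp only [h4] at h5 ⊢
  rw [integral_prod _ h5]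
  refine integral_congr_ae (ae_of_all _ fun y => ?_)
  simp only
  rw [integral_mul_const, repKernel]

/-- The Hilbert-Schmidt norm of `π_lam(F)` is the `L²` norm of its kernel, by Parseval's identity in
the variable `η` for almost every `ξ`. -/
theorem hsSq_fourierL1_eq_kernel {n : ℕ} {F : H n → ℂ} (hF : StronglyMeasurable F)
    (hFi : Integrable F) (lam : ℝ)
    (hk : ∫⁻ ξ, ∫⁻ y, ‖repKernel F lam ξ y‖ₑ ^ 2 ≠ ∞) :
    hsSq (fourierL1 F hFi lam) = ∫⁻ ξ, ∫⁻ y, ‖repKernel F lam ξ y‖ₑ ^ 2 := by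
  have hm := (stronglyMeasurable_repKernel hF lam)
  have hfin : ∀ᵐ ξ : E n, ∫⁻ y, ‖repKernel F lam ξ y‖ₑ ^ 2 < ∞ :=
    ae_lt_top' (hm.measurable.enorm.pow_const 2).lintegral_prod_right'.aemeasurable hk
  have h1 : ∀ i, ‖fourierL1 F hFi lam (onb n i)‖ₑ ^ 2 =
      ∫⁻ ξ, ‖fourierL1 F hFi lam (onb n i) ξ‖ₑ ^ 2 := fun i => (lintegral_enorm_sq_coeFn _).symm
  rw [hsSq]
  simp only [h1]
  rw [← lintegral_tsum fun i =>
    ((Lp.stronglyMeasurable _).measurable.enorm.pow_const 2).aemeasurable]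
  refine lintegral_congr_ae ?_
  filter_upwards [hfin, ae_all_iff.2 fun i => fourierL1_ae_kernel hF hFi lam (onb n i)]
    with ξ hξ hi
  simp only [hi]
  have hshift : ∫⁻ η, ‖repKernel F lam ξ (η - ξ)‖ₑ ^ 2 = ∫⁻ y, ‖repKernel F lam ξ y‖ₑ ^ 2 :=
    lintegral_sub_right_eq_self (fun y => ‖repKernel F lam ξ y‖ₑ ^ 2) ξ
  have hmem : MemLp (fun η => repKernel F lam ξ (η - ξ)) 2 (volume : Measure (E n)) := by
    rw [memLp_two_iff_lintegral, hshift]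
    · exact hξ.ne
    · exact (hm.comp_measurable ((measurable_const.prodMk
        (measurable_id.sub measurable_const)) :
        Measurable fun η : E n => (ξ, η - ξ))).aestronglyMeasurable
  rw [tsum_enorm_sq_integral_mul hmem, hshift]

theorem lintegral_comp_smul_add {n : ℕ} (f : E n → ℝ≥0∞) {lam : ℝ} (h : lam ≠ 0) (a : E n) :
    ENNReal.ofReal (|lam| ^ n) * ∫⁻ ξ : E n, f (lam • (ξ + a)) = ∫⁻ ξ, f ξ := by
  rw [lintegral_add_right_eq_self (fun ξ : E n => f (lam • ξ)) a]
  have hemb := (Homeomorph.smulOfNeZero (α := E n) lam h).measurableEmbedding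
  have h1 : ∫⁻ ξ : E n, f (lam • ξ) = ∫⁻ ξ, f ξ ∂(Measure.map (lam • ·) volume) :=
    (hemb.lintegral_map f).symm
  rw [h1, Measure.map_addHaar_smul _ h, lintegral_smul_measure, smul_eq_mul, ← mul_assoc,
    finrank_euclideanSpace, Fintype.card_fin, ← ENNReal.ofReal_mul (by positivity), abs_inv,
    abs_pow, mul_inv_cancel₀ (by positivity), ENNReal.ofReal_one, one_mul]

/-- The `L²` norm of the kernel of `π_lam(F)`.  For fixed `y` the kernel is the Fourier transform of
`centralFourier F lam (y, ·)` at `lam (ξ + y / 2)`, and the dilation by `lam` accounts for the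
factor `|lam|ⁿ`. -/
theorem lintegral_repKernel {n : ℕ} {F : H n → ℂ} (hF : StronglyMeasurable F)
    (hFi : Integrable F) {lam : ℝ} (hlam : lam ≠ 0)
    (h2 : ∫⁻ p : E n × E n, ‖centralFourier F lam p‖ₑ ^ 2 ≠ ∞) :
    ENNReal.ofReal (|lam| ^ n) * ∫⁻ ξ, ∫⁻ y, ‖repKernel F lam ξ y‖ₑ ^ 2 =
      ∫⁻ p : E n × E n, ‖centralFourier F lam p‖ₑ ^ 2 := by
  have hm := stronglyMeasurable_repKernel hF lam
  have hc := stronglyMeasurable_centralFourier hF lam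
  have hcm : Measurable fun p : E n × E n => ‖centralFourier F lam p‖ₑ ^ 2 :=
    hc.measurable.enorm.pow_const 2
  rw [lintegral_lintegral_swap (hm.measurable.enorm.pow_const 2).aemeasurable,
    ← lintegral_const_mul _ (hm.measurable.enorm.pow_const 2).lintegral_prod_left']
  rw [Measure.volume_eq_prod, lintegral_prod _ hcm.aemeasurable] at h2 ⊢
  refine lintegral_congr_ae ?_
  filter_upwards [ae_lt_top hcm.lintegral_prod_right' h2,
    (integrable_centralFourier hFi lam).prod_right_ae] with y hy hyi
  have hmem : MemLp (fun x => centralFourier F lam (y, x)) 2 (volume : Measure (E n)) :=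
    (memLp_two_iff_lintegral hyi.1).2 hy.ne
  rw [← lintegral_enorm_sq_integral_e hyi hmem,
    ← lintegral_comp_smul_add (fun w => ‖∫ x, centralFourier F lam (y, x) *
      e (inner ℝ x w)‖ₑ ^ 2) hlam ((1 / 2 : ℝ) • y)]
  congr 1
  refine lintegral_congr fun ξ => ?_
  simp only [repKernel, inner_smul_right, inner_add_right]

/-- **Plancherel's theorem** for the group Fourier transform on `L¹ ∩ L²`. -/
theorem lintegral_hsSq_fourierL1 {n : ℕ} (F : L2H n) (hFi : Integrable F) :
    ∫⁻ lam : ℝ, hsSq (fourierL1 F hFi lam) * ENNReal.ofReal (|lam| ^ n) = ‖F‖ₑ ^ 2 := by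
  have hF : StronglyMeasurable (F : H n → ℂ) := Lp.stronglyMeasurable F
  have hcm : Measurable fun q : ℝ × (E n × E n) => ‖centralFourier (F : H n → ℂ) q.1 q.2‖ₑ ^ 2 :=
    (stronglyMeasurable_centralFourier_uncurry hF).measurable.enorm.pow_const 2
  have hFm : Measurable fun q : (E n × E n) × ℝ => ‖F (q.1.2, q.1.1, q.2)‖ₑ ^ 2 :=
    (hF.measurable.comp (rearrange n).measurable).enorm.pow_const 2
  have htot : ∫⁻ p : E n × E n, ∫⁻ t : ℝ, ‖F (p.2, p.1, t)‖ₑ ^ 2 = ‖F‖ₑ ^ 2 := by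
    rw [← lintegral_enorm_sq_coeFn F,
      ← (measurePreserving_rearrange n).lintegral_comp_emb (rearrange n).measurableEmbedding,
      ← lintegral_prod _ hFm.aemeasurable]
    rfl
  have hFtop : ‖F‖ₑ ^ 2 ≠ ∞ := ENNReal.pow_ne_top enorm_ne_top
  -- Plancherel's theorem in the central variable, for almost every `(y, x)`.
  have key : ∫⁻ lam : ℝ, ∫⁻ p : E n × E n, ‖centralFourier F lam p‖ₑ ^ 2 = ‖F‖ₑ ^ 2 := by
    rw [lintegral_lintegral_swap hcm.aemeasurable, ← htot]
    refine lintegral_congr_ae ?_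
    have h2 := htot ▸ hFtop
    filter_upwards [ae_lt_top hFm.lintegral_prod_right' h2,
      (integrable_rearrange hFi).prod_right_ae] with p hp hpi
    have hmem : MemLp (fun t => F (p.2, p.1, t)) 2 (volume : Measure ℝ) :=
      (memLp_two_iff_lintegral hpi.1).2 hp.ne
    rw [← lintegral_enorm_sq_integral_e hpi hmem]
    rfl
  have hae := ae_lt_top hcm.lintegral_prod_right' (key ▸ hFtop)
  rw [← key]
  refine lintegral_congr_ae ?_
  have h0 : ∀ᵐ lam : ℝ, lam ≠ 0 := by simp [ae_iff]
  filter_upwards [hae, h0] with lam h1 hlam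
  have h3 := lintegral_repKernel hF hFi hlam h1.ne
  have hw0 : ENNReal.ofReal (|lam| ^ n) ≠ 0 := by
    rw [ne_eq, ENNReal.ofReal_eq_zero, not_le]
    exact pow_pos (abs_pos.2 hlam) n
  rw [hsSq_fourierL1_eq_kernel hF hFi lam, mul_comm, h3]
  intro htop
  rw [htop, ENNReal.mul_top hw0] at h3
  exact h1.ne h3.symm

end KernelFormula

/-! ### The Hilbert-Schmidt norm -/

section HilbertSchmidtNorm

variable {n : ℕ}

theorem hsSq_eq_tsum_tsum (S : L2E n →L[ℂ] L2E n) :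
    hsSq S = ∑' i, ∑' j, ‖inner ℂ (onb n j) (S (onb n i))‖ₑ ^ 2 :=
  tsum_congr fun _ => (tsum_enorm_sq_inner (onb n) _).symm

/-- The operator norm is bounded by the Hilbert-Schmidt norm. -/
theorem enorm_apply_sq_le_hsSq (S : L2E n →L[ℂ] L2E n) (v : L2E n) :
    ‖S v‖ₑ ^ 2 ≤ hsSq S * ‖v‖ₑ ^ 2 := by
  -- The adjoint has the same Hilbert-Schmidt norm.
  have hadj : hsSq S = ∑' j, ‖ContinuousLinearMap.adjoint S (onb n j)‖ₑ ^ 2 := by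
    rw [hsSq_eq_tsum_tsum, ENNReal.tsum_comm]
    refine tsum_congr fun j => ?_
    rw [← tsum_enorm_sq_inner (onb n) (ContinuousLinearMap.adjoint S (onb n j))]
    refine tsum_congr fun i => ?_
    rw [ContinuousLinearMap.adjoint_inner_right, ← inner_conj_symm, RCLike.enorm_conj]
  rw [← tsum_enorm_sq_inner (onb n) (S v), hadj, ← ENNReal.tsum_mul_right]
  refine ENNReal.tsum_le_tsum fun j => ?_
  rw [← ContinuousLinearMap.adjoint_inner_left, ← mul_pow]
  gcongr
  rw [← ofReal_norm, ← ofReal_norm, ← ofReal_norm, ← ENNReal.ofReal_mul (norm_nonneg _)]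
  exact ENNReal.ofReal_le_ofReal (norm_inner_le_norm _ _)

theorem enorm_sq_le_hsSq (S : L2E n →L[ℂ] L2E n) : ‖S‖ₑ ^ 2 ≤ hsSq S := by
  by_cases h : hsSq S = ∞
  · simp [h]
  have hb : ‖S‖ ≤ Real.sqrt (hsSq S).toReal := by
    refine S.opNorm_le_bound (Real.sqrt_nonneg _) fun v => ?_
    have h1 := ENNReal.toReal_mono
      (ENNReal.mul_ne_top h (ENNReal.pow_ne_top enorm_ne_top)) (enorm_apply_sq_le_hsSq S v)
    rw [ENNReal.toReal_mul, ENNReal.toReal_pow, ENNReal.toReal_pow, toReal_enorm, toReal_enorm]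
      at h1
    rw [← Real.sqrt_sq (norm_nonneg (S v)), ← Real.sqrt_sq (norm_nonneg v),
      ← Real.sqrt_mul ENNReal.toReal_nonneg]
    exact Real.sqrt_le_sqrt h1
  rw [← ofReal_norm, ← ENNReal.ofReal_pow (norm_nonneg _)]
  refine ENNReal.ofReal_le_of_le_toReal ?_
  calc ‖S‖ ^ 2 ≤ Real.sqrt (hsSq S).toReal ^ 2 := by gcongr
    _ = (hsSq S).toReal := Real.sq_sqrt ENNReal.toReal_nonneg

theorem hsSq_eq_zero {S : L2E n →L[ℂ] L2E n} (h : hsSq S = 0) : S = 0 := by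
  have h1 := enorm_sq_le_hsSq S
  rw [h, nonpos_iff_eq_zero, pow_eq_zero_iff two_ne_zero, ← ofReal_norm,
    ENNReal.ofReal_eq_zero] at h1
  exact norm_le_zero_iff.1 h1

theorem hsSq_smul (c : ℂ) (S : L2E n →L[ℂ] L2E n) : hsSq (c • S) = ‖c‖ₑ ^ 2 * hsSq S := by
  simp only [hsSq, smul_apply, enorm_smul, mul_pow, ENNReal.tsum_mul_left]

theorem hsSq_neg (S : L2E n →L[ℂ] L2E n) : hsSq (-S) = hsSq S := by
  simp [hsSq]

theorem hsSq_sub_comm (S T : L2E n →L[ℂ] L2E n) : hsSq (S - T) = hsSq (T - S) := by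
  rw [← hsSq_neg, neg_sub]

/-- The triangle inequality for the Hilbert-Schmidt norm. -/
theorem hsSq_add_rpow_le (S T : L2E n →L[ℂ] L2E n) :
    hsSq (S + T) ^ (1 / 2 : ℝ) ≤ hsSq S ^ (1 / 2 : ℝ) + hsSq T ^ (1 / 2 : ℝ) := by
  let ι := (exists_hilbertBasis ℂ (L2E n)).choose
  let _ : MeasurableSpace ι := ⊤
  have hc : ∀ S : L2E n →L[ℂ] L2E n,
      hsSq S = ∫⁻ i : ι, ‖S (onb n i)‖ₑ ^ (2 : ℝ) ∂Measure.count := by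
    intro S
    rw [lintegral_count]
    simp [hsSq]
    rfl
  simp only [hc]
  refine le_trans ?_ (ENNReal.lintegral_Lp_add_le (μ := Measure.count)
    (f := fun i : ι => ‖S (onb n i)‖ₑ) (g := fun i : ι => ‖T (onb n i)‖ₑ)
    measurable_from_top.aemeasurable measurable_from_top.aemeasurable one_le_two)
  gcongr with i
  exact enorm_add_le _ _

/-- Lower semicontinuity of the Hilbert-Schmidt norm. -/
theorem hsSq_mul_le_liminf {A : ℕ → L2E n →L[ℂ] L2E n} {L : L2E n →L[ℂ] L2E n}
    (h : Tendsto A atTop (𝓝 L)) {w : ℝ≥0∞} (hw : w ≠ ∞) :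
    hsSq L * w ≤ liminf (fun k => hsSq (A k) * w) atTop := by
  let ι := (exists_hilbertBasis ℂ (L2E n)).choose
  let _ : MeasurableSpace ι := ⊤
  have hc : ∀ S : L2E n →L[ℂ] L2E n,
      hsSq S * w = ∫⁻ i : ι, ‖S (onb n i)‖ₑ ^ 2 * w ∂Measure.count := by
    intro S
    rw [lintegral_count, ENNReal.tsum_mul_right]
    rfl
  simp only [hc]
  refine le_trans (le_of_eq ?_) (lintegral_liminf_le fun k => measurable_from_top)
  refine lintegral_congr fun i => ?_
  refine (Tendsto.liminf_eq ?_).symm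
  have h1 : Tendsto (fun k => A k (onb n i)) atTop (𝓝 (L (onb n i))) :=
    ((ContinuousLinearMap.apply ℂ (L2E n) (onb n i)).continuous.tendsto L).comp h
  exact ENNReal.Tendsto.mul_const (ENNReal.Tendsto.pow h1.enorm) (Or.inr hw)

end HilbertSchmidtNorm

/-! ### Square integrable fields of operators -/

section OperatorFields

variable {n : ℕ}

/-- Weak measurability of a field of operators. -/
def WeaklyMeasurable (T : ℝ → (L2E n →L[ℂ] L2E n)) : Prop :=
  ∀ u v : L2E n, AEStronglyMeasurable (fun lam => inner ℂ u (T lam v)) volume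

theorem WeaklyMeasurable.add_smul {T S : ℝ → (L2E n →L[ℂ] L2E n)} (hT : WeaklyMeasurable T)
    (hS : WeaklyMeasurable S) {c : ℝ → ℂ} (hc : AEStronglyMeasurable c volume) :
    WeaklyMeasurable fun lam => T lam + c lam • S lam := by
  intro u v
  simp only [add_apply, smul_apply, inner_add_right,
    inner_smul_right]
  exact (hT u v).add (hc.mul (hS u v))

theorem weaklyMeasurable_zero : WeaklyMeasurable fun _ => (0 : L2E n →L[ℂ] L2E n) := fun u v => by
  simpa using aestronglyMeasurable_const

theorem WeaklyMeasurable.smul {S : ℝ → (L2E n →L[ℂ] L2E n)}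
    (hS : WeaklyMeasurable S) {c : ℝ → ℂ} (hc : AEStronglyMeasurable c volume) :
    WeaklyMeasurable fun lam => c lam • S lam := by
  simpa using weaklyMeasurable_zero.add_smul hS hc

theorem WeaklyMeasurable.sub {T S : ℝ → (L2E n →L[ℂ] L2E n)} (hT : WeaklyMeasurable T)
    (hS : WeaklyMeasurable S) : WeaklyMeasurable fun lam => T lam - S lam := by
  simpa [sub_eq_add_neg] using
    hT.add_smul hS (c := fun _ => -1) aestronglyMeasurable_const

theorem WeaklyMeasurable.aemeasurable_hsSq {T : ℝ → (L2E n →L[ℂ] L2E n)}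
    (hT : WeaklyMeasurable T) : AEMeasurable fun lam => hsSq (T lam) := by
  simp only [hsSq_eq_tsum_tsum]
  exact AEMeasurable.tsum fun i => AEMeasurable.tsum fun j => (hT _ _).enorm.pow_const 2

/-- The density of `|lam|ⁿ dlam`. -/
def weight (n : ℕ) (lam : ℝ) : ℝ≥0∞ := ENNReal.ofReal (|lam| ^ n)

theorem measurable_weight (n : ℕ) : Measurable (weight n) :=
  Continuous.measurable (ENNReal.continuous_ofReal.comp (continuous_abs.pow n))

theorem weight_ne_top (n : ℕ) (lam : ℝ) : weight n lam ≠ ∞ := ENNReal.ofReal_ne_top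

theorem weight_ne_zero {n : ℕ} {lam : ℝ} (h : lam ≠ 0) : weight n lam ≠ 0 := by
  rw [weight, ne_eq, ENNReal.ofReal_eq_zero, not_le]
  exact pow_pos (abs_pos.2 h) n

/-- The norm of `L²(ℝ*, B₂; |lam|ⁿ dlam)`. -/
def fieldNorm (T : ℝ → (L2E n →L[ℂ] L2E n)) : ℝ≥0∞ :=
  (∫⁻ lam, hsSq (T lam) * weight n lam) ^ (1 / 2 : ℝ)

theorem fieldNorm_sq (T : ℝ → (L2E n →L[ℂ] L2E n)) :
    fieldNorm T ^ 2 = ∫⁻ lam, hsSq (T lam) * weight n lam := by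
  rw [fieldNorm, ← ENNReal.rpow_natCast, ← ENNReal.rpow_mul]
  norm_num

theorem fieldNorm_sub_comm (T S : ℝ → (L2E n →L[ℂ] L2E n)) :
    fieldNorm (fun lam => T lam - S lam) = fieldNorm fun lam => S lam - T lam := by
  simp only [fieldNorm, hsSq_sub_comm]

theorem fieldNorm_const_smul (c : ℂ) (T : ℝ → (L2E n →L[ℂ] L2E n)) :
    fieldNorm (fun lam => c • T lam) = ‖c‖ₑ * fieldNorm T := by
  simp only [fieldNorm, hsSq_smul, mul_assoc]
  rw [lintegral_const_mul' _ _ (ENNReal.pow_ne_top enorm_ne_top),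
    ENNReal.mul_rpow_of_nonneg _ _ (by norm_num), ← ENNReal.rpow_natCast, ← ENNReal.rpow_mul]
  norm_num

theorem fieldNorm_add_le {T S : ℝ → (L2E n →L[ℂ] L2E n)} (hT : WeaklyMeasurable T)
    (hS : WeaklyMeasurable S) :
    fieldNorm (fun lam => T lam + S lam) ≤ fieldNorm T + fieldNorm S := by
  have hm : ∀ {T : ℝ → (L2E n →L[ℂ] L2E n)}, WeaklyMeasurable T →
      AEMeasurable (fun lam => (hsSq (T lam) * weight n lam) ^ (1 / 2 : ℝ)) := fun hT =>
    (hT.aemeasurable_hsSq.mul (measurable_weight n).aemeasurable).pow_const _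
  have hsq : ∀ z : ℝ≥0∞, z = (z ^ (1 / 2 : ℝ)) ^ (2 : ℝ) := fun z => by
    rw [← ENNReal.rpow_mul]; norm_num
  have hc : ∀ T : ℝ → (L2E n →L[ℂ] L2E n), fieldNorm T =
      (∫⁻ lam, ((hsSq (T lam) * weight n lam) ^ (1 / 2 : ℝ)) ^ (2 : ℝ)) ^ (1 / 2 : ℝ) := by
    intro T
    simp only [← hsq]
    rfl
  simp only [hc]
  refine le_trans ?_ (ENNReal.lintegral_Lp_add_le (hm hT) (hm hS) one_le_two)
  gcongr with lam
  simp only [Pi.add_apply]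
  rw [ENNReal.mul_rpow_of_nonneg _ _ (by norm_num), ENNReal.mul_rpow_of_nonneg _ _ (by norm_num),
    ENNReal.mul_rpow_of_nonneg _ _ (by norm_num), ← add_mul]
  gcongr
  exact hsSq_add_rpow_le _ _

theorem ae_eq_of_fieldNorm_sub_eq_zero {T S : ℝ → (L2E n →L[ℂ] L2E n)}
    (hT : WeaklyMeasurable T) (hS : WeaklyMeasurable S)
    (h : fieldNorm (fun lam => T lam - S lam) = 0) : ∀ᵐ lam, T lam = S lam := by
  have h1 := fieldNorm_sq fun lam => T lam - S lam
  rw [h, zero_pow two_ne_zero] at h1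
  replace h1 := (lintegral_eq_zero_iff'
    ((hT.sub hS).aemeasurable_hsSq.mul (measurable_weight n).aemeasurable)).1 h1.symm
  have h0 : ∀ᵐ lam : ℝ, lam ≠ 0 := by simp [ae_iff]
  filter_upwards [h1, h0] with lam h2 h3
  exact sub_eq_zero.1 (hsSq_eq_zero ((mul_eq_zero.1 h2).resolve_right (weight_ne_zero h3)))

end OperatorFields

/-! ### The group Fourier transform on `L¹` -/

section FourierOnL1

variable {n : ℕ}

theorem fourierL1_apply {F : H n → ℂ} (hF : Integrable F) (lam : ℝ) (u : L2E n) :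
    fourierL1 F hF lam u = ∫ X, F X • rep lam X u := rfl

theorem fourierL1_add_smul {F F' : L2H n} (c : ℂ) (hF : Integrable F) (hF' : Integrable F')
    (hS : Integrable (F + c • F' : L2H n)) (lam : ℝ) :
    fourierL1 _ hS lam = fourierL1 _ hF lam + c • fourierL1 _ hF' lam := by
  ext1 u
  simp only [add_apply, smul_apply, fourierL1_apply]
  have hi : Integrable fun X => c • F' X • rep lam X u := (integrable_smul_rep hF' lam u).smul c
  rw [← integral_smul, ← integral_add (integrable_smul_rep hF lam u) hi]
  refine integral_congr_ae ?_
  filter_upwards [Lp.coeFn_add F (c • F'), Lp.coeFn_smul c F'] with X h1 h2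
  rw [h1, Pi.add_apply, h2, Pi.smul_apply, add_smul, smul_assoc]

theorem integrable_add_smul {F F' : L2H n} (c : ℂ) (hF : Integrable F) (hF' : Integrable F') :
    Integrable (F + c • F' : L2H n) := by
  refine (hF.add (hF'.smul c)).congr ?_
  filter_upwards [Lp.coeFn_add F (c • F'), Lp.coeFn_smul c F'] with X h1 h2
  rw [h1, Pi.add_apply, Pi.add_apply, h2]

theorem continuous_inner_fourierL1 {F : H n → ℂ} (hF : Integrable F) (u v : L2E n) :
    Continuous fun lam => inner ℂ u (fourierL1 F hF lam v) := by
  have h : ∀ lam, inner ℂ u (fourierL1 F hF lam v) = ∫ X, F X * inner ℂ u (rep lam X v) := by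
    intro lam
    rw [fourierL1_apply, ← integral_inner (integrable_smul_rep hF lam v)]
    simp only [inner_smul_right]
  simp only [h]
  refine continuous_of_dominated (bound := fun X => ‖F X‖ * (‖u‖ * ‖v‖)) (fun lam => ?_)
    (fun lam => ae_of_all _ fun X => ?_) (hF.norm.mul_const _) (ae_of_all _ fun X => ?_)
  · exact hF.1.mul (continuous_const.inner (continuous_rep lam v)).aestronglyMeasurable
  · rw [norm_mul]
    gcongr
    refine (norm_inner_le_norm _ _).trans_eq ?_
    rw [LinearIsometry.norm_map]
  · refine continuous_const.mul (continuous_const.inner ?_)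
    exact continuous_phase (fun lam : ℝ => (⟨fun ξ => lam * (X.2.2 + inner ℝ X.1 ξ +
      (1 / 2 : ℝ) * inner ℝ X.1 X.2.1), by fun_prop⟩ : C(E n, ℝ)))
      (fun ξ => by simp only [ContinuousMap.coe_mk]; fun_prop) _

theorem weaklyMeasurable_fourierL1 {F : H n → ℂ} (hF : Integrable F) :
    WeaklyMeasurable (fourierL1 F hF) := fun u v =>
  (continuous_inner_fourierL1 hF u v).aestronglyMeasurable

theorem fieldNorm_fourierL1 (F : L2H n) (hF : Integrable F) :
    fieldNorm (fourierL1 F hF) = ‖F‖ₑ := by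
  have h := lintegral_hsSq_fourierL1 F hF
  change ∫⁻ lam, hsSq (fourierL1 F hF lam) * weight n lam = _ at h
  rw [fieldNorm, h, ← ENNReal.rpow_natCast, ← ENNReal.rpow_mul]
  norm_num

theorem fieldNorm_fourierL1_sub (F F' : L2H n) (hF : Integrable F) (hF' : Integrable F') :
    fieldNorm (fun lam => fourierL1 F hF lam - fourierL1 F' hF' lam) = ‖F - F'‖ₑ := by
  have h := fieldNorm_fourierL1 _ (integrable_add_smul (-1) hF hF')
  have h1 : F + (-1 : ℂ) • F' = F - F' := by simp [sub_eq_add_neg]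
  rw [← h1, ← h]
  congr 1
  funext lam
  rw [fourierL1_add_smul (-1) hF hF']
  simp [sub_eq_add_neg]

/-- Translation in the centre of the group becomes multiplication by a character. -/
theorem fourierL1_leftTranslate_central {F : L2H n} (hF : Integrable F) (s : ℝ)
    (hT : Integrable (leftTranslate ((0, 0, s) : H n) F)) (lam : ℝ) :
    fourierL1 _ hT lam = e (s * lam) • fourierL1 _ hF lam := by
  ext1 u
  set A : H n := (0, 0, s) with hA
  have hmp := measurePreserving_mulH (invH A)
  have hrep : ∀ Y : H n, rep lam (mulH A Y) u = e (s * lam) • rep lam Y u := by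
    intro Y
    refine Lp.ext ?_
    filter_upwards [rep_ae lam (mulH A Y) u, rep_ae lam Y u,
      Lp.coeFn_smul (e (s * lam)) (rep lam Y u)] with ξ h1 h2 h3
    rw [h1, h3, Pi.smul_apply, h2, smul_eq_mul]
    simp only [mulH, hA, zero_add, inner_zero_right, sub_self, mul_zero, add_zero]
    rw [mul_add, e_add, mul_comm s lam]
    ring
  have hAA : ∀ X : H n, mulH A (mulH (invH A) X) = X := by
    intro X
    simp [mulH, invH, hA]
  simp only [smul_apply, fourierL1_apply]
  rw [← integral_smul]
  have h1 : ∫ X, (leftTranslate A F : H n → ℂ) X • rep lam X u =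
      ∫ X, (fun Y => F Y • rep lam (mulH A Y) u) (mulH (invH A) X) := by
    refine integral_congr_ae ?_
    filter_upwards [Lp.coeFn_compMeasurePreserving F hmp] with X hX
    simp only [hAA]
    congr 1
  rw [h1]
  have h2 : Integrable (fun Y => F Y • rep lam (mulH A Y) u) := by
    simp only [hrep, smul_comm _ (e (s * lam))]
    exact (integrable_smul_rep hF lam u).smul (e (s * lam))
  have h3 := integral_map (φ := mulH (invH A)) (μ := volume)
    (f := fun Y => F Y • rep lam (mulH A Y) u) hmp.measurable.aemeasurable
    (by rw [hmp.map_eq]; exact h2.1)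
  rw [hmp.map_eq] at h3
  rw [← h3]
  simp only [hrep, smul_comm _ (e (s * lam))]

theorem integrable_leftTranslate {F : L2H n} (hF : Integrable F) (A : H n) :
    Integrable (leftTranslate A F) := by
  have hmp := measurePreserving_mulH (invH A)
  refine (hmp.integrable_comp_of_integrable hF).congr ?_
  exact (Lp.coeFn_compMeasurePreserving F hmp).symm

end FourierOnL1

/-! ### The group Fourier transform on `L²` -/

section FourierOnL2

variable {n : ℕ}

theorem isFourier_zero : IsFourier (0 : L2H n) (fun _ => 0) := by
  have h0 : Integrable ((0 : L2H n) : H n → ℂ) :=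
    (integrable_zero _ _ _).congr (Lp.coeFn_zero ℂ 2 volume).symm
  have hz : fourierL1 _ h0 = fun _ => 0 := by
    funext lam
    ext1 u
    rw [fourierL1_apply, zero_apply]
    refine integral_eq_zero_of_ae ?_
    filter_upwards [Lp.coeFn_zero ℂ 2 (volume : Measure (H n))] with X hX
    rw [hX]
    simp
  refine ⟨weaklyMeasurable_zero, by simp [hsSq], fun _ => 0, fun _ => h0, tendsto_const_nhds, ?_⟩
  simp only [hz]
  simp [hsSq]

theorem tendsto_fieldNorm_of_sq {T : ℕ → ℝ → (L2E n →L[ℂ] L2E n)} :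
    Tendsto (fun j => fieldNorm (T j)) atTop (𝓝 0) ↔
      Tendsto (fun j => ∫⁻ lam : ℝ, hsSq (T j lam) * ENNReal.ofReal (|lam| ^ n)) atTop (𝓝 0) := by
  constructor
  · intro h
    have h2 := ENNReal.Tendsto.pow (n := 2) h
    simp only [fieldNorm_sq, zero_pow two_ne_zero] at h2
    exact h2
  · intro h
    have h2 := ((ENNReal.continuous_rpow_const (y := (1 / 2 : ℝ))).tendsto 0).comp h
    rw [ENNReal.zero_rpow_of_pos (by norm_num)] at h2
    exact h2

theorem IsFourier.add_smul {f g : L2H n} {T S : ℝ → (L2E n →L[ℂ] L2E n)} (hf : IsFourier f T)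
    (hg : IsFourier g S) (c : ℂ) : IsFourier (f + c • g) fun lam => T lam + c • S lam := by
  have hTm : WeaklyMeasurable T := hf.measurable
  have hSm : WeaklyMeasurable S := hg.measurable
  have hcS : WeaklyMeasurable fun lam => c • S lam :=
    hSm.smul (c := fun _ => c) aestronglyMeasurable_const
  refine ⟨hTm.add_smul hSm (c := fun _ => c) aestronglyMeasurable_const, ?_, ?_⟩
  · have h1 := fieldNorm_add_le hTm hcS
    have h2 : fieldNorm (fun lam => T lam + c • S lam) ≠ ∞ := by
      refine ne_top_of_le_ne_top (ENNReal.add_ne_top.2 ⟨?_, ?_⟩) h1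
      · exact ENNReal.rpow_ne_top_of_nonneg (by norm_num) hf.finite.ne
      · rw [fieldNorm_const_smul]
        exact ENNReal.mul_ne_top enorm_ne_top
          (ENNReal.rpow_ne_top_of_nonneg (by norm_num) hg.finite.ne)
    have h3 := ENNReal.pow_ne_top (n := 2) h2
    rw [fieldNorm_sq] at h3
    exact h3.lt_top
  · obtain ⟨F, hF, hFlim, hFT⟩ := hf.limit
    obtain ⟨F', hF', hFlim', hFS⟩ := hg.limit
    refine ⟨fun j => F j + c • F' j, fun j => integrable_add_smul c (hF j) (hF' j),
      hFlim.add (hFlim'.const_smul c), ?_⟩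
    rw [← tendsto_fieldNorm_of_sq] at hFT hFS ⊢
    have hlim := hFT.add (ENNReal.Tendsto.const_mul (a := ‖c‖ₑ) hFS (Or.inr enorm_ne_top))
    rw [mul_zero, add_zero] at hlim
    refine tendsto_of_tendsto_of_tendsto_of_le_of_le tendsto_const_nhds hlim
      (fun j => zero_le) fun j => ?_
    have h1 : WeaklyMeasurable fun lam => fourierL1 _ (hF j) lam - T lam :=
      (weaklyMeasurable_fourierL1 (hF j)).sub hTm
    have h2 : WeaklyMeasurable fun lam => fourierL1 _ (hF' j) lam - S lam :=
      (weaklyMeasurable_fourierL1 (hF' j)).sub hSm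
    simp only
    rw [← fieldNorm_const_smul]
    refine le_trans (le_of_eq ?_)
      (fieldNorm_add_le h1 (h2.smul (c := fun _ => c) aestronglyMeasurable_const))
    congr 1
    funext lam
    rw [fourierL1_add_smul c (hF j) (hF' j), smul_sub]
    abel

/-- **Plancherel's theorem** on `L²(ℍⁿ)`. -/
theorem IsFourier.fieldNorm_eq {f : L2H n} {T : ℝ → (L2E n →L[ℂ] L2E n)} (hf : IsFourier f T) :
    fieldNorm T = ‖f‖ₑ := by
  have hTm : WeaklyMeasurable T := hf.measurable
  obtain ⟨F, hF, hFlim, hFT⟩ := hf.limit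
  rw [← tendsto_fieldNorm_of_sq] at hFT
  have hm : ∀ j, WeaklyMeasurable fun lam => fourierL1 _ (hF j) lam - T lam := fun j =>
    (weaklyMeasurable_fourierL1 (hF j)).sub hTm
  have hnorm : Tendsto (fun j => ‖F j‖ₑ) atTop (𝓝 ‖f‖ₑ) := hFlim.enorm
  refine le_antisymm ?_ ?_
  · have h := hFT.add hnorm
    rw [zero_add] at h
    refine ge_of_tendsto' h fun j => ?_
    have h1 := fieldNorm_add_le (hTm.sub (weaklyMeasurable_fourierL1 (hF j)))
      (weaklyMeasurable_fourierL1 (hF j))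
    simp only [sub_add_cancel] at h1
    rwa [fieldNorm_sub_comm, fieldNorm_fourierL1] at h1
  · have h := hFT.add (tendsto_const_nhds (x := fieldNorm T))
    rw [zero_add] at h
    refine le_of_tendsto_of_tendsto' hnorm h fun j => ?_
    have h1 := fieldNorm_add_le (hm j) hTm
    simp only [sub_add_cancel] at h1
    rwa [fieldNorm_fourierL1] at h1

theorem IsFourier.ae_unique {f : L2H n} {T S : ℝ → (L2E n →L[ℂ] L2E n)} (hT : IsFourier f T)
    (hS : IsFourier f S) : ∀ᵐ lam, T lam = S lam := by
  refine ae_eq_of_fieldNorm_sub_eq_zero hT.measurable hS.measurable ?_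
  have h := (hT.add_smul hS (-1)).fieldNorm_eq
  simpa [sub_eq_add_neg] using h

theorem exists_integrable_norm_sub_lt (f : L2H n) {ε : ℝ} (hε : 0 < ε) :
    ∃ F : L2H n, Integrable F ∧ ‖F - f‖ < ε := by
  obtain ⟨g, hg⟩ := (Lp.simpleFunc.denseRange (E := ℂ) (μ := (volume : Measure (H n)))
    (p := 2) ENNReal.ofNat_ne_top).exists_dist_lt f hε
  refine ⟨g, ?_, by rwa [dist_comm, dist_eq_norm] at hg⟩
  have h1 := Lp.simpleFunc.memLp g
  rw [SimpleFunc.memLp_iff_integrable two_ne_zero ENNReal.ofNat_ne_top] at h1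
  exact h1.congr (Lp.simpleFunc.toSimpleFunc_eq_toFun g)

/-- Existence of the Fourier transform: along a rapidly convergent sequence in `L¹ ∩ L²` the
transforms converge in operator norm for almost every parameter, and by Fatou's lemma also in
`L²(ℝ*, B₂; |lam|ⁿ dlam)`. -/
theorem exists_isFourier (f : L2H n) : ∃ T, IsFourier f T := by
  choose F hF hFf using fun j : ℕ => exists_integrable_norm_sub_lt f (ε := (1 / 4 : ℝ) ^ j / 2)
    (by positivity)
  set A : ℕ → ℝ → (L2E n →L[ℂ] L2E n) := fun j => fourierL1 _ (hF j) with hA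
  have hAm : ∀ j, WeaklyMeasurable (A j) := fun j => weaklyMeasurable_fourierL1 (hF j)
  have hFF : ∀ j k, j ≤ k → ‖F k - F j‖ ≤ (1 / 4 : ℝ) ^ j := by
    intro j k hjk
    have h1 : ‖F k - F j‖ ≤ ‖F k - f‖ + ‖F j - f‖ := by
      rw [← norm_neg (F j - f), neg_sub]
      exact norm_sub_le_norm_sub_add_norm_sub _ _ _
    have h2 : (1 / 4 : ℝ) ^ k ≤ (1 / 4) ^ j := pow_le_pow_of_le_one (by norm_num) (by norm_num) hjk
    linarith [hFf j, hFf k]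
  have hAA : ∀ j k, j ≤ k → ∫⁻ lam, hsSq (A k lam - A j lam) * weight n lam ≤
      ENNReal.ofReal ((1 / 16 : ℝ) ^ j) := by
    intro j k hjk
    rw [← fieldNorm_sq, fieldNorm_fourierL1_sub, ← ofReal_norm,
      ← ENNReal.ofReal_pow (norm_nonneg _)]
    refine ENNReal.ofReal_le_ofReal ?_
    calc ‖F k - F j‖ ^ 2 ≤ ((1 / 4 : ℝ) ^ j) ^ 2 := by gcongr; exact hFF j k hjk
      _ = (1 / 16 : ℝ) ^ j := by rw [← pow_mul, mul_comm, pow_mul]; norm_num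
  have hDm : ∀ j k, AEMeasurable fun lam => hsSq (A k lam - A j lam) * weight n lam := fun j k =>
    ((hAm k).sub (hAm j)).aemeasurable_hsSq.mul (measurable_weight n).aemeasurable
  -- Weighting the increments by `4 ^ j` makes their decay geometric at almost every parameter.
  have hsum : ∫⁻ lam, ∑' j : ℕ, ENNReal.ofReal (4 ^ j) *
      (hsSq (A (j + 1) lam - A j lam) * weight n lam) ≠ ∞ := by
    rw [lintegral_tsum fun j => (hDm j (j + 1)).const_mul _]
    have h1 : ∀ j : ℕ, ∫⁻ lam, ENNReal.ofReal (4 ^ j) *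
        (hsSq (A (j + 1) lam - A j lam) * weight n lam) ≤ ENNReal.ofReal ((1 / 4 : ℝ) ^ j) := by
      intro j
      rw [lintegral_const_mul' _ _ ENNReal.ofReal_ne_top]
      refine (mul_le_mul_right (hAA j (j + 1) (Nat.le_succ j)) _).trans_eq ?_
      rw [← ENNReal.ofReal_mul (by positivity), ← mul_pow]
      norm_num
    refine ne_top_of_le_ne_top ?_ (ENNReal.tsum_le_tsum h1)
    rw [← ENNReal.ofReal_tsum_of_nonneg (fun j => by positivity)
      (summable_geometric_of_lt_one (by norm_num) (by norm_num))]
    exact ENNReal.ofReal_ne_top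
  have h0 : ∀ᵐ lam : ℝ, lam ≠ 0 := by simp [ae_iff]
  have hconv : ∀ᵐ lam : ℝ, ∃ L, Tendsto (fun j => A j lam) atTop (𝓝 L) := by
    filter_upwards [ae_lt_top' (AEMeasurable.tsum fun j => (hDm j (j + 1)).const_mul _) hsum, h0]
      with lam hlam hlam0
    set C : ℝ≥0∞ := (∑' j : ℕ, ENNReal.ofReal (4 ^ j) *
      (hsSq (A (j + 1) lam - A j lam) * weight n lam)) / weight n lam with hC
    have hCtop : C ≠ ∞ := ENNReal.div_ne_top hlam.ne (weight_ne_zero hlam0)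
    have hbound : ∀ j, dist (A j lam) (A (j + 1) lam) ≤ Real.sqrt C.toReal * (1 / 2 : ℝ) ^ j := by
      intro j
      have h1 : ENNReal.ofReal (4 ^ j) * ‖A (j + 1) lam - A j lam‖ₑ ^ 2 ≤ C := by
        rw [hC, ENNReal.le_div_iff_mul_le (Or.inl (weight_ne_zero hlam0))
          (Or.inl (weight_ne_top n lam)), mul_assoc]
        refine le_trans ?_ (ENNReal.le_tsum j)
        gcongr
        exact enorm_sq_le_hsSq _
      have h2 := ENNReal.toReal_mono hCtop h1
      rw [ENNReal.toReal_mul, ENNReal.toReal_pow, toReal_enorm,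
        ENNReal.toReal_ofReal (by positivity)] at h2
      rw [dist_comm, dist_eq_norm]
      have h3 : (2 ^ j * ‖A (j + 1) lam - A j lam‖) ^ 2 ≤ C.toReal := by
        rw [mul_pow, ← pow_mul, mul_comm j 2, pow_mul]
        norm_num
        exact h2
      have h4 := Real.le_sqrt_of_sq_le h3
      have h5 : (2 : ℝ) ^ j * (1 / 2) ^ j = 1 := by rw [← mul_pow]; norm_num
      calc ‖A (j + 1) lam - A j lam‖
          = (2 ^ j * ‖A (j + 1) lam - A j lam‖) * (1 / 2) ^ j := by
            rw [mul_right_comm, h5, one_mul]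
        _ ≤ _ := by gcongr
    exact cauchySeq_tendsto_of_complete
      (cauchySeq_of_le_geometric (1 / 2) _ (by norm_num) hbound)
  classical
  set T : ℝ → (L2E n →L[ℂ] L2E n) := fun lam =>
    if h : ∃ L, Tendsto (fun j => A j lam) atTop (𝓝 L) then h.choose else 0 with hT
  have hTlim : ∀ᵐ lam, Tendsto (fun j => A j lam) atTop (𝓝 (T lam)) := by
    filter_upwards [hconv] with lam h
    simp only [hT, dif_pos h]
    exact h.choose_spec
  have hTm : WeaklyMeasurable T := by
    intro u v
    refine aestronglyMeasurable_of_tendsto_ae atTop (fun j => hAm j u v) ?_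
    filter_upwards [hTlim] with lam h
    exact tendsto_const_nhds.inner
      (((ContinuousLinearMap.apply ℂ (L2E n) v).continuous.tendsto _).comp h)
  -- Fatou's lemma, applied to the limit in the second index.
  have hAT : ∀ j, ∫⁻ lam, hsSq (A j lam - T lam) * weight n lam ≤
      ENNReal.ofReal ((1 / 16 : ℝ) ^ j) := by
    intro j
    have h1 : ∫⁻ lam, hsSq (A j lam - T lam) * weight n lam ≤
        ∫⁻ lam, liminf (fun k => hsSq (A k lam - A j lam) * weight n lam) atTop := by
      refine lintegral_mono_ae ?_
      filter_upwards [hTlim] with lam h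
      rw [hsSq_sub_comm]
      exact hsSq_mul_le_liminf (h.sub_const _) (weight_ne_top n lam)
    refine h1.trans ((lintegral_liminf_le' fun k => hDm j k).trans ?_)
    refine liminf_le_of_frequently_le' (Eventually.frequently ?_)
    filter_upwards [eventually_ge_atTop j] with k hk using hAA j k hk
  have hzero : Tendsto (fun j : ℕ => ENNReal.ofReal ((1 / 16 : ℝ) ^ j)) atTop (𝓝 0) := by
    rw [← ENNReal.ofReal_zero]
    exact ENNReal.tendsto_ofReal
      (tendsto_pow_atTop_nhds_zero_of_lt_one (by norm_num) (by norm_num))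
  refine ⟨T, hTm, ?_, F, hF, ?_, ?_⟩
  · have h1 := fieldNorm_add_le (hTm.sub (hAm 0)) (hAm 0)
    simp only [sub_add_cancel] at h1
    have h2 : fieldNorm T ≠ ∞ := by
      refine ne_top_of_le_ne_top (ENNReal.add_ne_top.2 ⟨?_, ?_⟩) h1
      · rw [fieldNorm_sub_comm]
        exact ENNReal.rpow_ne_top_of_nonneg (by norm_num)
          (ne_top_of_le_ne_top ENNReal.ofReal_ne_top (hAT 0))
      · rw [fieldNorm_fourierL1]
        exact enorm_ne_top
    have h3 := ENNReal.pow_ne_top (n := 2) h2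
    rw [fieldNorm_sq] at h3
    exact h3.lt_top
  · rw [tendsto_iff_norm_sub_tendsto_zero]
    refine squeeze_zero (fun _ => norm_nonneg _) (fun j => (hFf j).le) ?_
    have := (tendsto_pow_atTop_nhds_zero_of_lt_one (r := (1 / 4 : ℝ)) (by norm_num)
      (by norm_num)).div_const 2
    simpa using this
  · exact tendsto_of_tendsto_of_tendsto_of_le_of_le tendsto_const_nhds hzero
      (fun j => zero_le) hAT

theorem IsFourier.leftTranslate_central {f : L2H n} {T : ℝ → (L2E n →L[ℂ] L2E n)}
    (hf : IsFourier f T) (s : ℝ) :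
    IsFourier (leftTranslate ((0, 0, s) : H n) f) fun lam => e (s * lam) • T lam := by
  have hTm : WeaklyMeasurable T := hf.measurable
  have hen : ∀ (lam : ℝ) (S : L2E n →L[ℂ] L2E n), hsSq (e (s * lam) • S) = hsSq S := by
    intro lam S
    rw [hsSq_smul, ← ofReal_norm, norm_e]
    simp
  obtain ⟨F, hF, hFlim, hFT⟩ := hf.limit
  refine ⟨hTm.smul (continuous_e.comp
    (continuous_const.mul continuous_id)).aestronglyMeasurable, ?_,
    fun j => leftTranslate (0, 0, s) (F j), fun j => integrable_leftTranslate (hF j) _,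
    ((leftTranslate _).continuous.tendsto f).comp hFlim, ?_⟩
  · simp only [hen]
    exact hf.finite
  · simp only [fourierL1_leftTranslate_central (hF _), ← smul_sub, hen]
    exact hFT

/-- The value chosen in the definition of `fourier` is a Fourier transform: the default value `0` is
never used. -/
theorem isFourier_fourier (f : L2H n) : IsFourier f (fourier f) := by
  have h := exists_isFourier f
  rw [fourier, dif_pos h]
  exact h.choose_spec

theorem weaklyMeasurable_fourier (f : L2H n) : WeaklyMeasurable (fourier f) :=
  (isFourier_fourier f).measurable

theorem lintegral_hsSq_fourier (f : L2H n) :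
    ∫⁻ lam, hsSq (fourier f lam) * weight n lam = ‖f‖ₑ ^ 2 := by
  rw [← fieldNorm_sq, (isFourier_fourier f).fieldNorm_eq]

theorem fourier_add_smul_ae (f g : L2H n) (c : ℂ) :
    ∀ᵐ lam, fourier (f + c • g) lam = fourier f lam + c • fourier g lam :=
  (isFourier_fourier _).ae_unique ((isFourier_fourier f).add_smul (isFourier_fourier g) c)

theorem fourier_zero_ae : ∀ᵐ lam, fourier (0 : L2H n) lam = 0 :=
  (isFourier_fourier _).ae_unique isFourier_zero

theorem fourier_leftTranslate_central_ae (f : L2H n) (s : ℝ) :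
    ∀ᵐ lam, fourier (leftTranslate ((0, 0, s) : H n) f) lam = e (s * lam) • fourier f lam :=
  (isFourier_fourier _).ae_unique ((isFourier_fourier f).leftTranslate_central s)

end FourierOnL2

/-! ### The Hilbert-Schmidt inner product -/

section HilbertSchmidtInner

variable {n : ℕ}

theorem hasSum_norm_sq {S : L2E n →L[ℂ] L2E n} (h : hsSq S ≠ ∞) :
    HasSum (fun i => ‖S (onb n i)‖ ^ 2) (hsSq S).toReal := by
  have h1 := ENNReal.hasSum_toReal h
  rw [← ENNReal.tsum_toReal_eq fun i => ENNReal.pow_ne_top enorm_ne_top] at h1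
  rw [hsSq]
  simpa using h1

theorem hsInner_self (S : L2E n →L[ℂ] L2E n) : hsInner S S = ((hsSq S).toReal : ℂ) := by
  rw [hsInner, hsSq, ENNReal.tsum_toReal_eq fun i => ENNReal.pow_ne_top enorm_ne_top,
    Complex.ofReal_tsum]
  refine tsum_congr fun i => ?_
  rw [inner_self_eq_norm_sq_to_K]
  simp

theorem hsSq_add_smul_ne_top {S T : L2E n →L[ℂ] L2E n} (hS : hsSq S ≠ ∞) (hT : hsSq T ≠ ∞)
    (c : ℂ) : hsSq (T + c • S) ≠ ∞ := by
  have h1 : hsSq (T + c • S) ^ (1 / 2 : ℝ) ≠ ∞ := by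
    refine ne_top_of_le_ne_top (ENNReal.add_ne_top.2 ⟨?_, ?_⟩) (hsSq_add_rpow_le T (c • S))
    · exact ENNReal.rpow_ne_top_of_nonneg (by norm_num) hT
    · rw [hsSq_smul]
      exact ENNReal.rpow_ne_top_of_nonneg (by norm_num)
        (ENNReal.mul_ne_top (ENNReal.pow_ne_top enorm_ne_top) hS)
  intro h
  rw [h, ENNReal.top_rpow_of_pos (by norm_num)] at h1
  exact h1 rfl

/-- Polarization of the Hilbert-Schmidt norm. -/
theorem hsInner_eq_polarization {S T : L2E n →L[ℂ] L2E n} (hS : hsSq S ≠ ∞) (hT : hsSq T ≠ ∞) :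
    hsInner S T = ((hsSq (T + (1 : ℂ) • S)).toReal - (hsSq (T + (-1 : ℂ) • S)).toReal +
      ((hsSq (T + (-Complex.I) • S)).toReal - (hsSq (T + Complex.I • S)).toReal) *
        Complex.I) / 4 := by
  have h : ∀ c : ℂ, HasSum (fun i => (((‖(T + c • S) (onb n i)‖ ^ 2 : ℝ)) : ℂ))
      ((hsSq (T + c • S)).toReal : ℂ) := fun c =>
    Complex.hasSum_ofReal.2 (hasSum_norm_sq (hsSq_add_smul_ne_top hS hT c))
  refine HasSum.tsum_eq ?_
  refine (((((h 1).sub (h (-1))).add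
    (((h (-Complex.I)).sub (h Complex.I)).mul_right Complex.I))).div_const 4).congr_fun fun i => ?_
  rw [inner_eq_sum_norm_sq_div_four]
  simp [sub_eq_add_neg]

/-- The Cauchy-Schwarz inequality for series in `ℝ≥0∞`. -/
theorem sq_tsum_mul_le {κ : Type*} (a b : κ → ℝ≥0∞) :
    (∑' i, a i * b i) ^ 2 ≤ (∑' i, a i ^ 2) * ∑' i, b i ^ 2 := by
  let _ : MeasurableSpace κ := ⊤
  have h := ENNReal.lintegral_mul_le_Lp_mul_Lq (Measure.count : Measure κ) (p := 2) (q := 2)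
    Real.HolderConjugate.two_two (f := a) (g := b)
    measurable_from_top.aemeasurable measurable_from_top.aemeasurable
  simp only [lintegral_count, Pi.mul_apply, ENNReal.rpow_ofNat] at h
  have hsq : ∀ z : ℝ≥0∞, (z ^ (1 / 2 : ℝ)) ^ 2 = z := fun z => by
    rw [← ENNReal.rpow_natCast, ← ENNReal.rpow_mul]; norm_num
  calc (∑' i, a i * b i) ^ 2
      ≤ ((∑' i, a i ^ 2) ^ (1 / 2 : ℝ) * (∑' i, b i ^ 2) ^ (1 / 2 : ℝ)) ^ 2 := by gcongr
    _ = _ := by rw [mul_pow, hsq, hsq]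

theorem enorm_hsInner_sq_le (S T : L2E n →L[ℂ] L2E n) :
    ‖hsInner S T‖ₑ ^ 2 ≤ hsSq S * hsSq T := by
  refine le_trans ?_ (sq_tsum_mul_le (fun i => ‖S (onb n i)‖ₑ) fun i => ‖T (onb n i)‖ₑ)
  gcongr
  refine enorm_tsum_le_tsum_enorm.trans (ENNReal.tsum_le_tsum fun i => ?_)
  rw [mul_comm, ← ofReal_norm, ← ofReal_norm, ← ofReal_norm, ← ENNReal.ofReal_mul (norm_nonneg _)]
  exact ENNReal.ofReal_le_ofReal (norm_inner_le_norm _ _)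

theorem hsInner_smul_left (c : ℂ) (S T : L2E n →L[ℂ] L2E n) :
    hsInner (c • S) T = c * hsInner S T := by
  simp only [hsInner, smul_apply, inner_smul_right, tsum_mul_left]

end HilbertSchmidtInner

/-! ### Brackets -/

section FourierPairing

variable {n : ℕ}

/-- The density `⟨f̂(lam), ĝ(lam)⟩ |lam|ⁿ` of the inner product `⟨f, g⟩`. -/
def pairing (f g : L2H n) (lam : ℝ) : ℂ :=
  hsInner (fourier f lam) (fourier g lam) * ((|lam| ^ n : ℝ) : ℂ)

/-- The density `‖f̂(lam)‖² |lam|ⁿ` of the squared norm `‖f‖²`. -/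
def normDensity (f : L2H n) (lam : ℝ) : ℝ≥0∞ := hsSq (fourier f lam) * weight n lam

theorem aemeasurable_normDensity (f : L2H n) : AEMeasurable (normDensity f) :=
  (weaklyMeasurable_fourier f).aemeasurable_hsSq.mul (measurable_weight n).aemeasurable

theorem lintegral_normDensity (f : L2H n) : ∫⁻ lam, normDensity f lam = ‖f‖ₑ ^ 2 :=
  lintegral_hsSq_fourier f

theorem lintegral_normDensity_ne_top (f : L2H n) : ∫⁻ lam, normDensity f lam ≠ ∞ := by
  rw [lintegral_normDensity]
  exact ENNReal.pow_ne_top enorm_ne_top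

theorem ae_hsSq_fourier_ne_top (f : L2H n) : ∀ᵐ lam, hsSq (fourier f lam) ≠ ∞ := by
  have h0 : ∀ᵐ lam : ℝ, lam ≠ 0 := by simp [ae_iff]
  filter_upwards [ae_lt_top' (aemeasurable_normDensity f) (lintegral_normDensity_ne_top f), h0]
    with lam h1 h2 h3
  rw [normDensity, h3, ENNReal.top_mul (weight_ne_zero h2)] at h1
  exact lt_irrefl _ h1

theorem toReal_normDensity (f : L2H n) (lam : ℝ) :
    (normDensity f lam).toReal = (hsSq (fourier f lam)).toReal * |lam| ^ n := by
  rw [normDensity, ENNReal.toReal_mul, weight, ENNReal.toReal_ofReal (by positivity)]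

theorem integrable_toReal_normDensity (f : L2H n) :
    Integrable fun lam => (normDensity f lam).toReal :=
  integrable_toReal_of_lintegral_ne_top (aemeasurable_normDensity f)
    (lintegral_normDensity_ne_top f)

theorem integral_toReal_normDensity (f : L2H n) :
    ∫ lam, (normDensity f lam).toReal = ‖f‖ ^ 2 := by
  rw [integral_toReal (aemeasurable_normDensity f)
    (ae_lt_top' (aemeasurable_normDensity f) (lintegral_normDensity_ne_top f)),
    lintegral_normDensity]
  simp

/-- The pairing in terms of norm densities, which transfers integrability and Plancherel's theorem
from norms to inner products. -/
theorem pairing_ae_eq (f g : L2H n) : pairing f g =ᵐ[volume] fun lam =>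
    (((normDensity (g + (1 : ℂ) • f) lam).toReal : ℂ) -
      ((normDensity (g + (-1 : ℂ) • f) lam).toReal : ℂ) +
      (((normDensity (g + (-Complex.I) • f) lam).toReal : ℂ) -
        ((normDensity (g + Complex.I • f) lam).toReal : ℂ)) * Complex.I) / 4 := by
  filter_upwards [ae_hsSq_fourier_ne_top f, ae_hsSq_fourier_ne_top g,
    fourier_add_smul_ae g f 1, fourier_add_smul_ae g f (-1),
    fourier_add_smul_ae g f (-Complex.I), fourier_add_smul_ae g f Complex.I]
    with lam hf hg h1 h2 h3 h4
  rw [pairing, hsInner_eq_polarization hf hg]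
  simp only [toReal_normDensity, h1, h2, h3, h4]
  push_cast
  ring

theorem integrable_pairing (f g : L2H n) : Integrable (pairing f g) := by
  refine Integrable.congr ?_ (pairing_ae_eq f g).symm
  have h := fun c : ℂ => (integrable_toReal_normDensity (g + c • f)).ofReal (𝕜 := ℂ)
  exact (((h 1).sub (h (-1))).add (((h (-Complex.I)).sub (h Complex.I)).mul_const _)).div_const 4

/-- **Parseval's formula** for the group Fourier transform. -/
theorem integral_pairing (f g : L2H n) : ∫ lam, pairing f g lam = inner ℂ g f := by
  have h : ∀ c : ℂ, Integrable fun lam => ((normDensity (g + c • f) lam).toReal : ℂ) := fun c =>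
    (integrable_toReal_normDensity (g + c • f)).ofReal
  have h' : ∀ c : ℂ, ∫ lam, ((normDensity (g + c • f) lam).toReal : ℂ) =
      ((‖g + c • f‖ ^ 2 : ℝ) : ℂ) := fun c => by
    rw [← integral_toReal_normDensity]
    exact integral_ofReal
  have hsub : ∀ c d : ℂ, Integrable fun lam => ((normDensity (g + c • f) lam).toReal : ℂ) -
      ((normDensity (g + d • f) lam).toReal : ℂ) := fun c d => (h c).sub (h d)
  rw [integral_congr_ae (pairing_ae_eq f g), integral_div,
    integral_add (hsub 1 (-1)) ((hsub (-Complex.I) Complex.I).mul_const _),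
    integral_mul_const, integral_sub (h 1) (h (-1)), integral_sub (h (-Complex.I)) (h Complex.I),
    h', h', h', h', inner_eq_sum_norm_sq_div_four]
  simp [sub_eq_add_neg]

theorem pairing_leftTranslate_central_ae (f g : L2H n) (s : ℝ) :
    pairing (leftTranslate ((0, 0, s) : H n) f) g =ᵐ[volume]
      fun lam => e (s * lam) * pairing f g lam := by
  filter_upwards [fourier_leftTranslate_central_ae f s] with lam h
  rw [pairing, pairing, h, hsInner_smul_left, mul_assoc]

/-- The periodization of `pairing f g`. -/
def bracket (f g : L2H n) (s : ℝ) : ℂ := ∑' r : ℤ, pairing f g (s + r)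

/-- The periodization of `normDensity f`. -/
def normBracket (f : L2H n) (s : ℝ) : ℝ≥0∞ := ∑' r : ℤ, normDensity f (s + r)

theorem integrable_bracket (f g : L2H n) : IntegrableOn (bracket f g) (Set.Ioc 0 1) :=
  (integrable_tsum_add_intCast (integrable_pairing f g)).1

/-- The Fourier coefficients of `bracket f g` are the inner products of `g` with the central
integer translates of `f`. -/
theorem integral_e_mul_bracket (f g : L2H n) (m : ℤ) :
    ∫ s in Set.Ioc (0 : ℝ) 1, e (m * s) * bracket f g s =
      inner ℂ g (leftTranslate ((0, 0, (m : ℝ)) : H n) f) := by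
  rw [← integral_pairing, integral_congr_ae (pairing_leftTranslate_central_ae f g m)]
  exact integral_e_mul_tsum (integrable_pairing f g) m

theorem tsum_add_intCast_add {α : Type*} [AddCommMonoid α] [TopologicalSpace α] (F : ℝ → α)
    (s : ℝ) (m : ℤ) : ∑' r : ℤ, F (s + m + r) = ∑' r : ℤ, F (s + r) := by
  rw [← (Equiv.addLeft m).tsum_eq fun r : ℤ => F (s + r)]
  refine tsum_congr fun r => ?_
  simp [add_assoc]

theorem bracket_add_intCast (f g : L2H n) (s : ℝ) (m : ℤ) :
    bracket f g (s + m) = bracket f g s := tsum_add_intCast_add _ s m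

theorem normBracket_add_intCast (f : L2H n) (s : ℝ) (m : ℤ) :
    normBracket f (s + m) = normBracket f s := tsum_add_intCast_add _ s m

theorem aemeasurable_normBracket (f : L2H n) :
    AEMeasurable (normBracket f) (volume.restrict (Set.Ioc (0 : ℝ) 1)) :=
  AEMeasurable.tsum fun r : ℤ => ((aemeasurable_normDensity f).comp_quasiMeasurePreserving
    (measurePreserving_add_right volume (r : ℝ)).quasiMeasurePreserving).restrict

theorem lintegral_normBracket_ne_top (f : L2H n) :
    ∫⁻ s in Set.Ioc (0 : ℝ) 1, normBracket f s ≠ ∞ := by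
  have h := lintegral_normDensity_ne_top f
  rwa [lintegral_eq_lintegral_Ioc_tsum (aemeasurable_normDensity f)] at h

theorem ae_normBracket_ne_top (f : L2H n) : ∀ᵐ s : ℝ, normBracket f s ≠ ∞ := by
  refine ae_of_ae_Ioc (fun s r h => ?_)
    (ae_tsum_ne_top (aemeasurable_normDensity f) (lintegral_normDensity_ne_top f))
  change normBracket f (s + r) ≠ ∞ at h
  rwa [normBracket_add_intCast] at h

theorem bracket_self_ae (f : L2H n) :
    ∀ᵐ s : ℝ, bracket f f s = ((normBracket f s).toReal : ℂ) := by
  filter_upwards [ae_normBracket_ne_top f] with s hs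
  rw [bracket, normBracket, ENNReal.tsum_toReal_eq fun r => ENNReal.ne_top_of_tsum_ne_top hs r,
    Complex.ofReal_tsum]
  refine tsum_congr fun r => ?_
  rw [toReal_normDensity, pairing, hsInner_self]
  push_cast
  rfl

/-- The Cauchy-Schwarz inequality for the bracket. -/
theorem enorm_bracket_sq_le (f g : L2H n) (s : ℝ) :
    ‖bracket f g s‖ₑ ^ 2 ≤ normBracket f s * normBracket g s := by
  have hsq : ∀ z : ℝ≥0∞, (z ^ (1 / 2 : ℝ)) ^ 2 = z := fun z => by
    rw [← ENNReal.rpow_natCast, ← ENNReal.rpow_mul]; norm_num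
  have h := sq_tsum_mul_le (fun r : ℤ => normDensity f (s + r) ^ (1 / 2 : ℝ))
    fun r : ℤ => normDensity g (s + r) ^ (1 / 2 : ℝ)
  simp only [hsq] at h
  refine le_trans ?_ h
  gcongr
  refine enorm_tsum_le_tsum_enorm.trans (ENNReal.tsum_le_tsum fun r => ?_)
  have hsqrt : ∀ z : ℝ≥0∞, (z ^ 2) ^ (1 / 2 : ℝ) = z := fun z => by
    rw [← ENNReal.rpow_natCast, ← ENNReal.rpow_mul]; norm_num
  rw [← ENNReal.mul_rpow_of_nonneg _ _ (by norm_num), ← hsqrt ‖pairing f g (s + r)‖ₑ]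
  gcongr
  rw [pairing, enorm_mul, mul_pow, normDensity, normDensity, mul_mul_mul_comm]
  gcongr
  · exact enorm_hsInner_sq_le _ _
  · rw [sq, weight, ← ofReal_norm, Complex.norm_real, Real.norm_of_nonneg (by positivity)]

end FourierPairing

/-! ### Lattice translates -/

section LatticeTranslates

variable {n : ℕ}

theorem leftTranslate_ae (A : H n) (f : L2H n) :
    (leftTranslate A f : H n → ℂ) =ᵐ[volume] fun X => f (mulH (invH A) X) :=
  Lp.coeFn_compMeasurePreserving f (measurePreserving_mulH (invH A))

theorem leftTranslate_leftTranslate (A B : H n) (f : L2H n) :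
    leftTranslate A (leftTranslate B f) = leftTranslate (mulH A B) f := by
  refine Lp.ext ?_
  filter_upwards [leftTranslate_ae A (leftTranslate B f), leftTranslate_ae (mulH A B) f,
    (measurePreserving_mulH (invH A)).quasiMeasurePreserving.ae (leftTranslate_ae B f)]
    with X h1 h2 h3
  rw [h1, h2, h3]
  congr 1
  rw [← mulH_assoc]
  congr 1
  simp only [mulH, invH, inner_neg_left, inner_neg_right, neg_neg, Prod.mk.injEq]
  refine ⟨by abel, by abel, ?_⟩
  rw [real_inner_comm A.1, real_inner_comm A.2.1]
  ring

theorem leftTranslate_zero (f : L2H n) : leftTranslate 0 f = f := by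
  refine Lp.ext ?_
  filter_upwards [leftTranslate_ae 0 f] with X h
  rw [h]
  congr 1
  simp [mulH, invH]

theorem lat_zero : lat (0 : Fin n → ℤ) 0 0 = 0 := by
  simp only [lat, Pi.zero_apply, Int.cast_zero, mul_zero]
  rfl

theorem lat_central (m : ℤ) : lat (0 : Fin n → ℤ) 0 m = (0, 0, (m : ℝ)) := by
  simp only [lat, Pi.zero_apply, Int.cast_zero, mul_zero]
  rfl

theorem lat_neg (k l : Fin n → ℤ) (m : ℤ) : lat (-k) (-l) (-m) = invH (lat k l m) := by
  refine Prod.ext ?_ (Prod.ext ?_ ?_)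
  · ext i; simp [lat, invH]
  · ext i; simp [lat, invH]
  · simp [lat, invH]

theorem mulH_central_lat (m : ℤ) (k l : Fin n → ℤ) (m' : ℤ) :
    mulH (0, 0, (m : ℝ)) (lat k l m') = lat k l (m + m') := by
  simp [mulH, lat]

theorem inner_leftTranslate_left (A : H n) (f g : L2H n) :
    inner ℂ (leftTranslate A f) g = inner ℂ f (leftTranslate (invH A) g) := by
  have h : leftTranslate A (leftTranslate (invH A) g) = g := by
    have h1 : mulH A (invH A) = 0 := by
      simp [mulH, invH, real_inner_comm, Prod.ext_iff]
    rw [leftTranslate_leftTranslate, h1, leftTranslate_zero]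
  conv_lhs => rw [← h]
  exact (leftTranslate A).inner_map_map _ _

/-- The lattice translations in the definition of a canonical dual can be moved to `φ`, as the set of
lattice points is closed under inversion. -/
theorem isCanonicalDual_iff {ψ φ : L2H n} : IsCanonicalDual ψ φ ↔
    ∀ (k l : Fin n → ℤ) (m : ℤ), inner ℂ (leftTranslate (lat k l m) φ) ψ =
      if (k, l, m) = (0, 0, 0) then 1 else 0 := by
  constructor <;> intro h k l m
  · rw [inner_leftTranslate_left, ← lat_neg, h]
    simp
  · have h1 := h (-k) (-l) (-m)
    rw [inner_leftTranslate_left, ← lat_neg] at h1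
    simpa using h1

/-- As the zero lattice point acts trivially, `G φ 0 0` is the bracket of `φ` with itself. -/
theorem G_zero_zero (φ : L2H n) : G φ 0 0 = bracket φ φ := by
  funext s
  rw [G, lat_zero, leftTranslate_zero]
  rfl

end LatticeTranslates

/-! ### Canonical duals -/

section CanonicalDual

variable {n : ℕ} {φ : L2H n}

theorem lat_mem_V (k l : Fin n → ℤ) (m : ℤ) : leftTranslate (lat k l m) φ ∈ V φ :=
  Submodule.le_topologicalClosure _ (Submodule.subset_span ⟨(k, l, m), rfl⟩)

/-- There is at most one canonical dual in `V φ`: a difference of two is orthogonal to the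
generators of `V φ`. -/
theorem eq_of_isCanonicalDual {ψ ψ' : L2H n} (hψ : ψ ∈ V φ) (hψ' : ψ' ∈ V φ)
    (h : IsCanonicalDual ψ φ) (h' : IsCanonicalDual ψ' φ) : ψ = ψ' := by
  rw [isCanonicalDual_iff] at h h'
  have hle : V φ ≤ (Submodule.span ℂ {ψ - ψ'})ᗮ := by
    refine Submodule.topologicalClosure_minimal _ ?_ (Submodule.isClosed_orthogonal _)
    rw [Submodule.span_le]
    rintro _ ⟨⟨k, l, m⟩, rfl⟩
    rw [SetLike.mem_coe, Submodule.mem_orthogonal_singleton_iff_inner_left, inner_sub_right, h, h',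
      sub_self]
  have h0 := hle (sub_mem hψ hψ')
  rw [Submodule.mem_orthogonal_singleton_iff_inner_left, inner_self_eq_zero] at h0
  exact sub_eq_zero.1 h0

/-- Under condition C, lattice translates with different `(k, l)`-parts are orthogonal. -/
theorem ConditionC.inner_eq_zero (hC : ConditionC φ) {k l : Fin n → ℤ} (hkl : (k, l) ≠ (0, 0))
    (m m' : ℤ) : inner ℂ (leftTranslate (lat k l m) φ) (leftTranslate (lat 0 0 m') φ) = 0 := by
  have h1 : inner ℂ (leftTranslate (lat k l 0) φ) (leftTranslate (lat 0 0 (m' - m)) φ) = 0 := by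
    rw [lat_central, ← integral_e_mul_bracket]
    refine integral_eq_zero_of_ae ?_
    filter_upwards [hC k l hkl] with s hs
    change e (((m' - m : ℤ) : ℝ) * s) * G φ k l s = 0
    rw [hs, mul_zero]
  rwa [← (leftTranslate ((0, 0, (m : ℝ)) : H n)).inner_map_map, leftTranslate_leftTranslate,
    leftTranslate_leftTranslate, mulH_central_lat, mulH_central_lat, add_zero,
    add_sub_cancel] at h1

/-- The bracket of a canonical dual with `φ` has the Fourier coefficients of the constant `1`. -/
theorem IsCanonicalDual.bracket_ae_eq_one {ψ : L2H n} (h : IsCanonicalDual ψ φ) :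
    ∀ᵐ s ∂(volume.restrict (Set.Ioc (0 : ℝ) 1)), bracket ψ φ s = 1 := by
  have hone : IntegrableOn (fun _ : ℝ => (1 : ℂ)) (Set.Ioc 0 1) := by simp
  have h1 := ae_eq_zero_of_integral_e_mul ((integrable_bracket ψ φ).sub hone) fun m => ?_
  · filter_upwards [h1] with s hs using sub_eq_zero.1 hs
  have hb : ∀ {b : ℝ → ℂ}, IntegrableOn b (Set.Ioc 0 1) →
      IntegrableOn (fun s => e (m * s) * b s) (Set.Ioc 0 1) := fun hb =>
    hb.bdd_mul (c := 1)
      (continuous_e.comp (continuous_const.mul continuous_id)).aestronglyMeasurable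
      (ae_of_all _ fun s => (norm_e _).le)
  simp only [Pi.sub_apply, mul_sub]
  rw [integral_sub (hb (integrable_bracket ψ φ)) (hb hone), integral_e_mul_bracket, ← lat_central,
    h]
  simp only [mul_one, integral_e_intCast_mul]
  simp

/-- Since the bracket of a dual `ψ` with `φ` is `1`, the Cauchy-Schwarz inequality bounds `1 / G` by
`normBracket ψ`. -/
theorem IsCanonicalDual.invIntegrable {ψ : L2H n} (h : IsCanonicalDual ψ φ) :
    InvIntegrable (G φ 0 0) := by
  have key : ∀ᵐ s ∂(volume.restrict (Set.Ioc (0 : ℝ) 1)), G φ 0 0 s ≠ 0 ∧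
      ‖(G φ 0 0 s)⁻¹‖ₑ ≤ normBracket ψ s := by
    filter_upwards [h.bracket_ae_eq_one, ae_restrict_of_ae (ae_normBracket_ne_top φ),
      ae_restrict_of_ae (bracket_self_ae φ)] with s h1 h2 h3
    have h4 := enorm_bracket_sq_le ψ φ s
    rw [h1, enorm_one, one_pow] at h4
    have h5 : normBracket φ s ≠ 0 := fun h0 => by simp [h0] at h4
    have h6 : (normBracket φ s).toReal ≠ 0 := ENNReal.toReal_ne_zero.2 ⟨h5, h2⟩
    rw [G_zero_zero, h3]
    refine ⟨Complex.ofReal_ne_zero.2 h6, ?_⟩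
    rw [enorm_inv (Complex.ofReal_ne_zero.2 h6), ← ofReal_norm, Complex.norm_real,
      Real.norm_of_nonneg ENNReal.toReal_nonneg, ENNReal.ofReal_toReal h2, ← one_div]
    exact ENNReal.div_le_of_le_mul h4
  have hm : AEStronglyMeasurable (G φ 0 0) (volume.restrict (Set.Ioc (0 : ℝ) 1)) := by
    rw [G_zero_zero]; exact (integrable_bracket φ φ).1
  refine ⟨key.mono fun s hs => hs.1, hm.aemeasurable.inv.aestronglyMeasurable, ?_⟩
  refine lt_of_le_of_lt (lintegral_mono_ae (key.mono fun s hs => hs.2)) ?_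
  exact (lintegral_normBracket_ne_top ψ).lt_top

/-- The combination `∑ cₘ L_(0,0,m) φ`. -/
def centralCombination (φ : L2H n) : (ℤ →₀ ℂ) →ₗ[ℂ] L2H n :=
  Finsupp.linearCombination ℂ fun m : ℤ => leftTranslate (lat 0 0 m) φ

theorem centralCombination_mem_V (φ : L2H n) (c : ℤ →₀ ℂ) : centralCombination φ c ∈ V φ := by
  rw [centralCombination, Finsupp.linearCombination_apply]
  exact Submodule.sum_mem _ fun m _ => Submodule.smul_mem _ _ (lat_mem_V 0 0 m)

theorem fourier_centralCombination_ae (φ : L2H n) (c : ℤ →₀ ℂ) :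
    ∀ᵐ lam, fourier (centralCombination φ c) lam = trigPoly c lam • fourier φ lam := by
  induction c using Finsupp.induction_linear with
  | zero => simpa using fourier_zero_ae
  | add c d hc hd =>
    have h := fourier_add_smul_ae (centralCombination φ c) (centralCombination φ d) 1
    filter_upwards [hc, hd, h] with lam h1 h2 h3
    rw [one_smul, one_smul, ← map_add] at h3
    rw [h3, h1, h2, map_add, Pi.add_apply, add_smul]
  | single m a =>
    have h := fourier_add_smul_ae 0 (leftTranslate (lat 0 0 m) φ) a
    rw [lat_central, zero_add] at h
    filter_upwards [h, fourier_zero_ae, fourier_leftTranslate_central_ae φ m] with lam h1 h2 h3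
    rw [centralCombination, Finsupp.linearCombination_single, lat_central, h1, h2, h3, zero_add,
      trigPoly_apply, Finsupp.sum_single_index (by simp), smul_smul]

theorem lintegral_mul_normDensity {p : ℝ → ℂ} (hp : AEMeasurable p)
    (hper : ∀ (s : ℝ) (r : ℤ), p (s + r) = p s) (f : L2H n) :
    ∫⁻ lam, ‖p lam‖ₑ ^ 2 * normDensity f lam =
      ∫⁻ s in Set.Ioc (0 : ℝ) 1, ‖p s‖ₑ ^ 2 * normBracket f s := by
  have hm : AEMeasurable fun lam => ‖p lam‖ₑ ^ 2 * normDensity f lam :=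
    (hp.enorm.pow_const 2).mul (aemeasurable_normDensity f)
  rw [lintegral_eq_lintegral_Ioc_tsum hm]
  simp only [hper, ENNReal.tsum_mul_left]
  rfl

theorem fieldNorm_smul_fourier_sq (p : ℝ → ℂ) (f : L2H n) :
    fieldNorm (fun lam => p lam • fourier f lam) ^ 2 =
      ∫⁻ lam, ‖p lam‖ₑ ^ 2 * normDensity f lam := by
  rw [fieldNorm_sq]
  simp only [hsSq_smul, mul_assoc]
  rfl

theorem fieldNorm_congr_ae {T S : ℝ → (L2E n →L[ℂ] L2E n)} (h : ∀ᵐ lam, T lam = S lam) :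
    fieldNorm T = fieldNorm S := by
  rw [fieldNorm, fieldNorm]
  congr 1
  refine lintegral_congr_ae ?_
  filter_upwards [h] with lam h1
  rw [h1]

theorem fieldNorm_fourier_sub (f g : L2H n) :
    fieldNorm (fun lam => fourier f lam - fourier g lam) = ‖f - g‖ₑ := by
  have h1 : f + (-1 : ℂ) • g = f - g := by simp [sub_eq_add_neg]
  rw [← h1, ← (isFourier_fourier _).fieldNorm_eq]
  refine fieldNorm_congr_ae ?_
  filter_upwards [fourier_add_smul_ae f g (-1)] with lam h
  rw [h]
  simp [sub_eq_add_neg]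

/-- Every multiple `p φ̂` in `L²` with a multiplier `p` of period one is the Fourier transform of a
limit of combinations of the central translates of `φ`. -/
theorem exists_fourier_eq_smul {p : ℝ → ℂ} (hp : AEMeasurable p)
    (hper : ∀ (s : ℝ) (r : ℤ), p (s + r) = p s)
    (hp2 : ∫⁻ s in Set.Ioc (0 : ℝ) 1, ‖p s‖ₑ ^ 2 * normBracket φ s ≠ ∞) :
    ∃ ψ : L2H n, ψ ∈ closure (Set.range (centralCombination φ)) ∧
      ∀ᵐ lam, fourier ψ lam = p lam • fourier φ lam := by
  obtain ⟨c, hc⟩ := exists_trigPoly_tendsto (aemeasurable_normBracket φ)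
    (lintegral_normBracket_ne_top φ) hp.restrict hp2
  have hφ := weaklyMeasurable_fourier φ
  have hpφ : WeaklyMeasurable fun lam => p lam • fourier φ lam := hφ.smul hp.aestronglyMeasurable
  set u : ℕ → L2H n := fun j => centralCombination φ (c j) with hu
  have hd : Tendsto (fun j => fieldNorm fun lam => fourier (u j) lam - p lam • fourier φ lam)
      atTop (𝓝 0) := by
    rw [tendsto_fieldNorm_of_sq]
    refine hc.congr fun j => ?_
    have hq : AEMeasurable fun s => trigPoly (c j) s - p s :=
      (continuous_trigPoly _).measurable.aemeasurable.sub hp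
    rw [← lintegral_mul_normDensity hq
      (fun s r => by rw [trigPoly_add_intCast, hper]), ← fieldNorm_smul_fourier_sq]
    change _ = ∫⁻ lam, hsSq (fourier (u j) lam - p lam • fourier φ lam) * weight n lam
    rw [← fieldNorm_sq]
    congr 1
    refine fieldNorm_congr_ae ?_
    filter_upwards [fourier_centralCombination_ae φ (c j)] with lam h
    rw [h, sub_smul]
  have hdm : ∀ j, WeaklyMeasurable fun lam => fourier (u j) lam - p lam • fourier φ lam :=
    fun j => (weaklyMeasurable_fourier _).sub hpφ
  have htri : ∀ (j : ℕ) (f : L2H n),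
      fieldNorm (fun lam => fourier f lam - p lam • fourier φ lam) ≤
        ‖f - u j‖ₑ + fieldNorm fun lam => fourier (u j) lam - p lam • fourier φ lam := by
    intro j f
    rw [← fieldNorm_fourier_sub]
    refine le_trans (le_of_eq ?_)
      (fieldNorm_add_le ((weaklyMeasurable_fourier _).sub (weaklyMeasurable_fourier _)) (hdm j))
    simp only [sub_add_sub_cancel]
  -- The Fourier transform is isometric, so convergence of the transforms makes `u` Cauchy.
  have hcauchy : CauchySeq u := by
    rw [EMetric.cauchySeq_iff]
    intro ε hε
    have hev := hd.eventually (gt_mem_nhds (ENNReal.half_pos hε.ne'))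
    obtain ⟨N, hN⟩ := eventually_atTop.1 hev
    refine ⟨N, fun j hj k hk => ?_⟩
    have h1 : edist (u j) (u k) ≤
        fieldNorm (fun lam => fourier (u j) lam - p lam • fourier φ lam) +
          fieldNorm fun lam => fourier (u k) lam - p lam • fourier φ lam := by
      rw [edist_eq_enorm_sub, ← fieldNorm_fourier_sub,
        fieldNorm_sub_comm (fun lam => fourier (u k) lam)]
      refine le_trans (le_of_eq ?_)
        (fieldNorm_add_le (hdm j) (hpφ.sub (weaklyMeasurable_fourier (u k))))
      simp only [sub_add_sub_cancel]
    refine lt_of_le_of_lt h1 ?_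
    rw [← ENNReal.add_halves ε]
    exact ENNReal.add_lt_add (hN j hj) (hN k hk)
  obtain ⟨ψ, hψ⟩ := cauchySeq_tendsto_of_complete hcauchy
  refine ⟨ψ, mem_closure_of_tendsto hψ (Eventually.of_forall fun j => ⟨c j, rfl⟩), ?_⟩
  refine ae_eq_of_fieldNorm_sub_eq_zero (weaklyMeasurable_fourier ψ) hpφ ?_
  have h1 : Tendsto (fun j => ‖ψ - u j‖ₑ) atTop (𝓝 0) := by
    have h2 := (tendsto_const_nhds (x := ψ)).sub hψ
    rw [sub_self] at h2
    simpa using h2.enorm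
  have h2 := h1.add hd
  rw [add_zero] at h2
  exact le_antisymm (ge_of_tendsto' h2 fun j => htri j ψ) zero_le

/-- If `1/G` is integrable, then `φ̂ / G` is the Fourier transform of a canonical dual in `V φ`. -/
theorem exists_isCanonicalDual (hC : ConditionC φ) (hG : InvIntegrable (G φ 0 0)) :
    ∃ ψ ∈ V φ, IsCanonicalDual ψ φ ∧
      ∀ᵐ lam, fourier ψ lam = (G φ 0 0 lam)⁻¹ • fourier φ lam := by
  have hper : ∀ (s : ℝ) (r : ℤ), (G φ 0 0 (s + r))⁻¹ = (G φ 0 0 s)⁻¹ := fun s r => by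
    rw [G_zero_zero, bracket_add_intCast]
  have hm : AEMeasurable fun s => (G φ 0 0 s)⁻¹ := by
    refine AEMeasurable.inv ?_
    rw [G_zero_zero]
    exact AEMeasurable.tsum fun r : ℤ =>
      ((integrable_pairing φ φ).comp_add_right (r : ℝ)).1.aemeasurable
  -- `|1/G|² G = 1/G`, so square integrability for the weight `G` is the hypothesis.
  have hp2 : ∫⁻ s in Set.Ioc (0 : ℝ) 1, ‖(G φ 0 0 s)⁻¹‖ₑ ^ 2 * normBracket φ s ≠ ∞ := by
    refine ne_top_of_le_ne_top hG.2.2.ne (lintegral_mono_ae ?_)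
    filter_upwards [ae_restrict_of_ae (ae_normBracket_ne_top φ),
      ae_restrict_of_ae (bracket_self_ae φ), hG.1] with s h1 h2 h3
    have h4 : normBracket φ s = ‖G φ 0 0 s‖ₑ := by
      rw [G_zero_zero, h2, ← ofReal_norm, Complex.norm_real,
        Real.norm_of_nonneg ENNReal.toReal_nonneg, ENNReal.ofReal_toReal h1]
    rw [h4, sq, mul_assoc, ← enorm_mul, inv_mul_cancel₀ h3, enorm_one, mul_one]
  obtain ⟨ψ, hψ, hψF⟩ := exists_fourier_eq_smul hm hper hp2
  have hψV : ψ ∈ V φ := by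
    have hcl : IsClosed (V φ : Set (L2H n)) := Submodule.isClosed_topologicalClosure _
    refine closure_minimal ?_ hcl hψ
    rintro _ ⟨c, rfl⟩
    exact centralCombination_mem_V φ c
  refine ⟨ψ, hψV, ?_, hψF⟩
  rw [isCanonicalDual_iff]
  intro k l m
  by_cases hkl : (k, l) = (0, 0)
  · obtain ⟨rfl, rfl⟩ := Prod.mk.inj hkl
    have hone : ∀ᵐ s ∂(volume.restrict (Set.Ioc (0 : ℝ) 1)), bracket ψ φ s = 1 := by
      filter_upwards [ae_restrict_of_ae (ae_forall_add_intCast hψF), hG.1] with s h1 h2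
      have h3 : bracket ψ φ s = (G φ 0 0 s)⁻¹ * bracket φ φ s := by
        rw [bracket, bracket, ← tsum_mul_left]
        refine tsum_congr fun r => ?_
        rw [pairing, h1 r, hper, hsInner_smul_left, mul_assoc, ← pairing]
      rw [h3, ← G_zero_zero, inv_mul_cancel₀ h2]
    have h4 := integral_e_mul_bracket ψ φ (-m)
    rw [← lat_central] at h4
    have h5 := lat_neg (0 : Fin n → ℤ) 0 m
    rw [neg_zero] at h5
    rw [inner_leftTranslate_left, ← h5, ← h4]
    have h6 : ∫ s in Set.Ioc (0 : ℝ) 1, e (((-m : ℤ) : ℝ) * s) * bracket ψ φ s =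
        ∫ s in Set.Ioc (0 : ℝ) 1, e (((-m : ℤ) : ℝ) * s) := by
      refine integral_congr_ae ?_
      filter_upwards [hone] with s hs
      rw [hs, mul_one]
    rw [h6, integral_e_intCast_mul]
    simp
  · have hcl : IsClosed {f : L2H n | inner ℂ (leftTranslate (lat k l m) φ) f = 0} :=
      isClosed_eq (continuous_const.inner continuous_id) continuous_const
    have h1 : inner ℂ (leftTranslate (lat k l m) φ) ψ = 0 := by
      refine closure_minimal ?_ hcl hψ
      rintro _ ⟨c, rfl⟩
      rw [Set.mem_ofPred_eq, centralCombination, Finsupp.linearCombination_apply, Finsupp.sum,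
        inner_sum]
      refine Finset.sum_eq_zero fun m' _ => ?_
      rw [inner_smul_right, hC.inner_eq_zero hkl, mul_zero]
    rw [h1, if_neg]
    intro h
    simp only [Prod.mk.injEq] at h
    exact hkl (by rw [h.1, h.2.1])

end CanonicalDual

end HeisenbergTranslates

end

theorem theorem6p1 (n : ℕ) (φ : HeisenbergTranslates.L2H n)
    (hC : HeisenbergTranslates.ConditionC φ) :
    ((∃ ψ ∈ HeisenbergTranslates.V φ, HeisenbergTranslates.IsCanonicalDual ψ φ) ↔
      HeisenbergTranslates.InvIntegrable (HeisenbergTranslates.G φ 0 0)) ∧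
    ∀ ψ ∈ HeisenbergTranslates.V φ, HeisenbergTranslates.IsCanonicalDual ψ φ →
      ∀ᵐ lam : ℝ, HeisenbergTranslates.fourier ψ lam =
        (HeisenbergTranslates.G φ 0 0 lam)⁻¹ • HeisenbergTranslates.fourier φ lam := by
  refine ⟨⟨fun ⟨ψ, _, h⟩ => h.invIntegrable, fun hG => ?_⟩, fun ψ hψ h => ?_⟩
  · obtain ⟨ψ, hψ, h, -⟩ := HeisenbergTranslates.exists_isCanonicalDual hC hG
    exact ⟨ψ, hψ, h⟩
  · obtain ⟨ψ', hψ', h', hF⟩ := HeisenbergTranslates.exists_isCanonicalDual hC h.invIntegrable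
    rwa [HeisenbergTranslates.eq_of_isCanonicalDual hψ hψ' h h']
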